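/- **Theorem (Main theorem for face algebras).** *Setting.* Let $V$ be a finite set and let $F$ be a coquasitriangular face Hopf algebra over $\mathbb C$ with vertex set $V$. That is: $F$ is a unital algebra and a coalgebra, with $\Delta(ab)=\Delta(a)\Delta(b)$, and with elements $e^i,e_i$ ($i\in V$) such that $e^ie^j=\delta_{ij}e^i$, $e_ie_j=\delta_{ij}e_i$, $e^ie_j=e_je^i$, $\sum_i e^i=\sum_i e_i=1$, $\Delta(e^ie_j)=\sum_k e^ie_k\otimes e^ke_j$, $\epsilon(e^ie_j)=\delta_{ij}$, $\epsilon(ab)=\sum_k\epsilon(ae_k)\epsilon(e^kb)$. There is an anti-algebra and anti-coalgebra endomorphism $S$ with $S(a_{(1)})a_{(2)}=\sum_i\epsilon(ae_i)e_i$, $a_{(1)}S(a_{(2)})=\sum_i\epsilon(e^ia)e^i$, $S(a_{(1)})a_{(2)}S(a_{(3)})=S(a)$, $a_{(1)}S(a_{(2)})a_{(3)}=a$. There is a bilinear form $R$ on $F$ with $R(ab,c)=R(a,c_{(1)})R(b,c_{(2)})$, $R(c,ab)=R(c_{(1)},b)R(c_{(2)},a)$, $R(a_{(1)},b_{(1)})\,a_{(2)}b_{(2)}=b_{(1)}a_{(1)}\,R(a_{(2)},b_{(2)})$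 and, for $\tilde R(a,b)=R(S(a),b)$, $\tilde R(a_{(1)},b_{(1)})R(a_{(2)},b_{(2)})=\epsilon(ab)$ and $R(a_{(1)},b_{(1)})\tilde R(a_{(2)},b_{(2)})=\epsilon(ba)$. For an algebra $B$, linear maps $X:F\to B$ are multiplied by convolution, $(XY)(f)=X(f_{(1)})Y(f_{(2)})$; $U$ is the algebra of linear maps $F\to\mathbb C$, and $u\otimes b\in U\otimes B$ is the map $f\mapsto u(f)b$. Let $T=\mathrm{id}_F$, $R^+(f)=R(f,\cdot)$, $R^-(f)=\tilde R(\cdot,f)$, $U_\pm=R^\pm(F)\subseteq U$, and $E_i\in U$, $E_i(f)=\epsilon(fe_i)$. An element $f\in F$ is cocommutative if $\Delta(f)$ is invariant under the exchange of the two factors. (i) The cocommutative elements form a commutative (in general non-unital) subalgebra $I$ of $F$. Let $h\in I$. For a family of linear maps $T(t):F\to F$ with $T(0)=T$ put $m_\pm(t)=R^\pm(h_{(2)})\otimes T(t)(h_{(1)})$ and $M^\pm(t)=1\otimes T(t)(h)-m_\pm(t)$; write $m_\pm,M^\pm$ for the values at $t=0$, that is, $m_\pm=R^\pm(h_{(2)})\otimes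 h_{(1)}$ and $M^\pm=1\otimes h-m_\pm$. (ii) $M^\pm\in U_\pm\otimes F$ and $[1\otimes h,T]=[M^\pm,T]$. For a formal power series $T(t)$ in $t$ with $T(0)=T$, Heisenberg's equations of motion, $i\,df(t)/dt=[h,f(t)]$ for all $f\in F$ where $f(t)=T(t)(f)$, are equivalent to the Lax equation $i\,dT/dt=[M^+(t),T(t)]$, and also to $i\,dT/dt=[M^-(t),T(t)]$. (iii) As formal power series in $t$, the elements $g_\pm(t)=\exp(-it(1\otimes h))\exp(it(1\otimes h-M^\pm))$ are invertible, have coefficients in $U_\pm\otimes F$, and solve the factorization problem $g_-(t)^{-1}g_+(t)=\exp(it(m_+-m_-))$. One has $g_+(t)Tg_+(t)^{-1}=g_-(t)Tg_-(t)^{-1}=:T(t)$, and $T(t)$ satisfies $T(0)=T$, Heisenberg's equations and both Lax equations. With $M^\pm(t)$ formed from this $T(t)$, $g_\pm$ is the unique solution of $i\,dg/dt=M^\pm(t)g$, $g(0)=1$. (iv) (Dynamical Lax equations.) For $a,b\in V$ put $X(a,b)=(E_a\otimes1)X(E_b\otimes1)$. Then $T(a,b)$ is the map $f\mapsto fe_be^a$,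 and the $T(t)$ of (iii) satisfies $$i\frac{d}{dt}T(a,b)=\sum_{c\in V}\bigl(M^\pm(a,c)\,T(c,b)-T(a,c)\,M^\pm(c,b)\bigr).$$ Let now $(T^A_B)$ be a finite matrix of elements of $F$ with $\Delta T^A_B=\sum_CT^A_C\otimes T^C_B$, $\epsilon(T^A_B)=\delta_{AB}$, and $\pi:F\to B$ an algebra homomorphism; evaluate a linear map $X:F\to B$ as the matrix $(X(T^A_B))$, and put $H=\pi(h)$. Let $L=(\pi(T^A_B))$, let $m_\pm, M^\pm$ denote the matrices obtained from $\pi\circ m_\pm$, $\pi\circ M^\pm$, and let $X(a,b)=E_aXE_b$ for matrices $X$. Then $[H,L](a,b)=\sum_c\bigl(M^\pm(a,c)L(c,b)-L(a,c)M^\pm(c,b)\bigr)$. If $B$ is a complex Banach algebra, then (ii), (iii) hold for real time $t\in\mathbb R$ with the matrix exponential and norm derivatives. Here $M^\pm(t)$ has the entries $e^{-itH}(M^\pm)^A_Be^{itH}$. For differentiable $L(t)$ with $L(0)=L$, $i\,dL/dt=[H,L(t)]$ is equivalent to $i\,dL/dt=[M^\pm(t),L(t)]$ for either sign. The matrices $g_\pm(t)=e^{-itH}e^{it(H-M^\pm)}$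 are invertible and are matrices of elements of $U_\pm\otimes B$; $g_-(t)^{-1}g_+(t)=e^{it(m_+-m_-)}$; $L(t)=g_\pm(t)Lg_\pm(t)^{-1}$ is the same for both signs and solves these equations and their dynamical form; and $g_\pm$ is the unique solution of $i\,dg/dt=M^\pm(t)g$, $g(0)=1$. For every finite matrix $(\tau^C_D)$ with the same two properties, the trace $h=\sum_C\tau^C_C$ is cocommutative, and its Lax operators in a representation $\pi$ are given by the Boltzmann weights: $(M^+)^A_B=\delta_{AB}\pi(h)-\sum_{C,D}R(\tau^D_C,T^A_B)\,\pi(\tau^C_D)$ and $(M^-)^A_B=\delta_{AB}\pi(h)-\sum_{C,D}\tilde R(T^A_B,\tau^D_C)\,\pi(\tau^C_D)$. -/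

import Mathlib

open scoped TensorProduct
open Coalgebra WithConv

namespace FaceLax

/-! ### The algebra `U ⊗ F`, realised as linear maps on `F`

For a coalgebra `F` and an algebra `B`, `Conv k F B` is the convolution algebra of linear maps
`F → B`: `(X * Y)(f) = ∑ X(f₁) Y(f₂)`, with unit `f ↦ ε(f) 1`.
The dual algebra `U` of `F` is `Conv k F k`, and `u ⊗ b ∈ U ⊗ B` is the map `f ↦ u(f) b`.
The universal `T` is the identity map of `F`. -/

/-- The convolution algebra of linear maps `F → B`. -/
abbrev Conv (k F B : Type*) [Field k] [Ring F] [Algebra k F] [Ring B] [Algebra k B] : Type _ :=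
  WithConv (F →ₗ[k] B)

section Basic

variable {k F B : Type*} [Field k] [Ring F] [Algebra k F] [Coalgebra k F] [Ring B] [Algebra k B]

/-- The simple tensor `u ⊗ b`, `u ∈ U`, `b ∈ B`, as the map `f ↦ u(f) b`. -/
def tens (u : Conv k F k) (b : B) : Conv k F B :=
  toConv (u.ofConv.smulRight b)

/-- `1 ⊗ b`, that is `f ↦ ε(f) b`. -/
noncomputable def oneTens (b : B) : Conv k F B := tens (1 : Conv k F k) b

variable (k F) in
/-- The universal `T`: the identity map of `F`. -/
def univT : Conv k F F := toConv LinearMap.id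

variable (k) in
/-- Cocommutative elements: `Δ f` is invariant under the exchange of the two tensor factors. -/
def IsCocommutative (f : F) : Prop :=
  TensorProduct.comm k F F (comul f) = comul (R := k) f

/-- For a linear map `ρ : F → U`, an element `h ∈ F` and `X : F → B`, the element
`∑ ρ(h₂) ⊗ X(h₁)` of `U ⊗ B`. -/
noncomputable def contraction (ρ : F →ₗ[k] Conv k F k) (h : F) (X : Conv k F B) : Conv k F B :=
  toConv (dualTensorHom k F B
    (TensorProduct.map ((WithConv.linearEquiv k (F →ₗ[k] k)).toLinearMap ∘ₗ ρ) X.ofConv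
      (TensorProduct.comm k F F (comul h))))

end Basic

/-! ### Face Hopf algebras -/

/-- A face algebra with finite vertex set `V`: an algebra and coalgebra `F` with elements
`eUp i = e^i` and `eLo i = e_i`. The comultiplication is multiplicative, but it need not map
`1` to `1 ⊗ 1`, and the counit need not be multiplicative. -/
structure FaceAlgebra (k V F : Type*) [Field k] [Fintype V] [DecidableEq V] [Ring F]
    [Algebra k F] [Coalgebra k F] where
  eUp : V → F
  eLo : V → F
  eUp_mul_eUp : ∀ i j, eUp i * eUp j = if i = j then eUp i else 0
  eLo_mul_eLo : ∀ i j, eLo i * eLo j = if i = j then eLo i else 0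
  eUp_mul_eLo : ∀ i j, eUp i * eLo j = eLo j * eUp i
  sum_eUp : ∑ i, eUp i = 1
  sum_eLo : ∑ i, eLo i = 1
  comul_mul : ∀ a b : F, comul (R := k) (a * b) = comul (R := k) a * comul (R := k) b
  comul_e : ∀ i j, comul (R := k) (eUp i * eLo j) =
    ∑ l, (eUp i * eLo l) ⊗ₜ[k] (eUp l * eLo j)
  counit_e : ∀ i j, counit (R := k) (eUp i * eLo j) = if i = j then 1 else 0
  counit_mul : ∀ a b : F, counit (R := k) (a * b) =
    ∑ l, counit (R := k) (a * eLo l) * counit (R := k) (eUp l * b)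

section FaceAlgebra

variable {k V F : Type*} [Field k] [Fintype V] [DecidableEq V] [Ring F] [Algebra k F]
  [Coalgebra k F]

/-- `E_i ∈ U`, `⟨E_i, f⟩ = ε(f e_i)`. -/
noncomputable def FaceAlgebra.ELo (Q : FaceAlgebra k V F) (i : V) : Conv k F k :=
  toConv (counit ∘ₗ LinearMap.mulRight k (Q.eLo i))

/-- `E^i ∈ U`, `⟨E^i, f⟩ = ε(e^i f)`. -/
noncomputable def FaceAlgebra.EUp (Q : FaceAlgebra k V F) (i : V) : Conv k F k :=
  toConv (counit ∘ₗ LinearMap.mulLeft k (Q.eUp i))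

variable {B : Type*} [Ring B] [Algebra k B]

/-- The component `X(a, b) = (E_a ⊗ 1) X (E_b ⊗ 1)` of `X ∈ U ⊗ B` with fixed vertices `a`, `b`. -/
noncomputable def FaceAlgebra.vertex (Q : FaceAlgebra k V F) (a b : V) (X : Conv k F B) :
    Conv k F B :=
  tens (Q.ELo a) 1 * X * tens (Q.ELo b) 1

/-- `T(a, b) = T (1 ⊗ e_b e^a)`, the universal `T` with fixed vertices `a` and `b`. -/
noncomputable def FaceAlgebra.vertexT (Q : FaceAlgebra k V F) (a b : V) : Conv k F F :=
  toConv (LinearMap.mulRight k (Q.eLo b * Q.eUp a))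

end FaceAlgebra

/-- A face Hopf algebra: a face algebra with an antipode `S`, an anti-algebra and anti-coalgebra
endomorphism with `S T = ∑ E_i ⊗ e_i`, `T S = ∑ E^i ⊗ e^i`, `S T S = S`, `T S T = T`. -/
structure FaceHopfAlgebra (k V F : Type*) [Field k] [Fintype V] [DecidableEq V] [Ring F]
    [Algebra k F] [Coalgebra k F] extends FaceAlgebra k V F where
  S : F →ₗ[k] F
  S_mul : ∀ a b, S (a * b) = S b * S a
  S_one : S 1 = 1
  comul_S : ∀ a, comul (R := k) (S a) =
    TensorProduct.map S S (TensorProduct.comm k F F (comul a))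
  counit_S : ∀ a, counit (R := k) (S a) = counit (R := k) a
  S_conv_T : toConv S * univT k F = ∑ i, tens (toFaceAlgebra.ELo i) (eLo i)
  T_conv_S : univT k F * toConv S = ∑ i, tens (toFaceAlgebra.EUp i) (eUp i)
  S_conv_T_conv_S : toConv S * univT k F * toConv S = toConv S
  T_conv_S_conv_T : univT k F * toConv S * univT k F = univT k F

/-! ### Coquasitriangular structures -/

section Coquasitriangular

variable {k F : Type*} [Field k] [Ring F] [Algebra k F]

/-- `f ↦ ⟨R, f ⊗ id⟩`, for a bilinear form `R` on `F`. -/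
noncomputable def pairFst (R : F ⊗[k] F →ₗ[k] k) : F →ₗ[k] Conv k F k :=
  (WithConv.linearEquiv k (F →ₗ[k] k)).symm.toLinearMap ∘ₗ TensorProduct.curry R

/-- `f ↦ ⟨R, id ⊗ f⟩`, for a bilinear form `R` on `F`. -/
noncomputable def pairSnd (R : F ⊗[k] F →ₗ[k] k) : F →ₗ[k] Conv k F k :=
  (WithConv.linearEquiv k (F →ₗ[k] k)).symm.toLinearMap ∘ₗ (TensorProduct.curry R).flip

/-- `(S ⊗ id)(R)`: the bilinear form `a ⊗ b ↦ R(S a, b)`. -/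
noncomputable def twist (S : F →ₗ[k] F) (R : F ⊗[k] F →ₗ[k] k) : F ⊗[k] F →ₗ[k] k :=
  R ∘ₗ S.rTensor F

end Coquasitriangular

/-- A coquasitriangular face Hopf algebra: a universal `R ∈ (F ⊗ F)^*` such that, with
`R~ = (S ⊗ id)(R)` and all products taken in convolution algebras on `F ⊗ F`,
`R~ R = Δ(1)`, `R R~ = Δ'(1)`, where `⟨Δ(1), a ⊗ b⟩ = ε(ab)` and `⟨Δ'(1), a ⊗ b⟩ = ε(ba)`,
`R T₁ T₂ = T₂ T₁ R`, that is `∑ R(a₁,b₁) a₂ b₂ = ∑ b₁ a₁ R(a₂,b₂)`, and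
`(Δ ⊗ id)(R) = R₁₃ R₂₃`, `(id ⊗ Δ)(R) = R₁₃ R₁₂`. -/
structure CoquasitriangularFaceHopfAlgebra (k V F : Type*) [Field k] [Fintype V] [DecidableEq V]
    [Ring F] [Algebra k F] [Coalgebra k F] extends FaceHopfAlgebra k V F where
  R : F ⊗[k] F →ₗ[k] k
  Rtilde_mul_R : toConv (twist S R) * toConv R = toConv (counit ∘ₗ LinearMap.mul' k F)
  R_mul_Rtilde : toConv R * toConv (twist S R) =
    toConv (counit ∘ₗ LinearMap.mul' k F ∘ₗ (TensorProduct.comm k F F).toLinearMap)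
  RTT : toConv (R.smulRight (1 : F)) * toConv (LinearMap.mul' k F) =
    toConv (LinearMap.mul' k F ∘ₗ (TensorProduct.comm k F F).toLinearMap) *
      toConv (R.smulRight (1 : F))
  R_mul_left : ∀ a b, pairFst R (a * b) = pairFst R a * pairFst R b
  R_mul_right : ∀ a b, pairSnd R (a * b) = pairSnd R b * pairSnd R a

/-- The two signs. -/
inductive Sgn
  | plus
  | minus

/-! ### The Lax operators -/

namespace CoquasitriangularFaceHopfAlgebra

variable {k V F B : Type*} [Field k] [Fintype V] [DecidableEq V] [Ring F] [Algebra k F]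
  [Coalgebra k F] [Ring B] [Algebra k B] (Q : CoquasitriangularFaceHopfAlgebra k V F)

/-- `R~ = (S ⊗ id)(R)`. -/
noncomputable def Rtilde : F ⊗[k] F →ₗ[k] k := twist Q.S Q.R

/-- The maps `R^± : F → U`: `R^+(f) = ⟨R, f ⊗ id⟩` and `R^-(f) = ⟨R~, id ⊗ f⟩`. -/
noncomputable def Rpm : Sgn → F →ₗ[k] Conv k F k
  | Sgn.plus => pairFst Q.R
  | Sgn.minus => pairSnd Q.Rtilde

/-- `U_± ⊆ U`, the image of `R^±`. -/
noncomputable def Upm (s : Sgn) : Submodule k (Conv k F k) := LinearMap.range (Q.Rpm s)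

variable (B) in
/-- `U_± ⊗ B`, as a space of linear maps `F → B`. -/
noncomputable def UpmTensor (s : Sgn) : Submodule k (Conv k F B) :=
  Submodule.span k {x | ∃ u ∈ Q.Upm s, ∃ b : B, x = tens u b}

/-- `m_± = R^±(h₂) ⊗ X(h₁)`; here `X = T` gives `m_±` at time zero, and `X = T(t)` gives
`m_±(t)`. -/
noncomputable def m (s : Sgn) (h : F) (X : Conv k F B) : Conv k F B :=
  contraction (Q.Rpm s) h X

/-- `M^± = 1 ⊗ X(h) - m_±`. -/
noncomputable def M (s : Sgn) (h : F) (X : Conv k F B) : Conv k F B :=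
  oneTens (X h) - Q.m s h X

end CoquasitriangularFaceHopfAlgebra

/-! ### Formal time

A time-dependent element of an algebra `A` is a formal power series in the time `t`. -/

section FormalTime

open PowerSeries

variable {A : Type*} [Ring A] [Algebra ℂ A]

/-- `exp(t x)`. -/
noncomputable def fexp (x : A) : PowerSeries A :=
  PowerSeries.mk fun n => ((n.factorial : ℂ)⁻¹) • x ^ n

/-- `d/dt`. -/
noncomputable def fderivT (x : PowerSeries A) : PowerSeries A :=
  PowerSeries.mk fun n => ((n : ℂ) + 1) • PowerSeries.coeff (n + 1) x

variable {V F : Type*} [Fintype V] [DecidableEq V] [Ring F] [Algebra ℂ F] [Coalgebra ℂ F]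

/-- For a time-dependent linear map `T(t) : F → F` and `f ∈ F`, the time-dependent element
`f(t) = T(t)(f)` of `F`. -/
noncomputable def fapply (T : PowerSeries (Conv ℂ F F)) (f : F) : PowerSeries F :=
  PowerSeries.mk fun n => (PowerSeries.coeff n T).ofConv f

/-- `M^±(t) = 1 ⊗ T(t)(h) - R^±(h₂) ⊗ T(t)(h₁)`. -/
noncomputable def fM (Q : CoquasitriangularFaceHopfAlgebra ℂ V F) (s : Sgn) (h : F)
    (T : PowerSeries (Conv ℂ F F)) : PowerSeries (Conv ℂ F F) :=
  PowerSeries.mk fun n => Q.M s h (PowerSeries.coeff n T)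

/-- Heisenberg's equations of motion `i df/dt = [h, f]` for all `f ∈ F`,
where `f(t) = T(t)(f)`. -/
def IsHeisenberg (h : F) (T : PowerSeries (Conv ℂ F F)) : Prop :=
  ∀ f : F, Complex.I • fderivT (fapply T f) =
    PowerSeries.C h * fapply T f - fapply T f * PowerSeries.C h

/-- The Lax equation `i dT/dt = [M^±(t), T(t)]`. -/
def IsLax (Q : CoquasitriangularFaceHopfAlgebra ℂ V F) (s : Sgn) (h : F)
    (T : PowerSeries (Conv ℂ F F)) : Prop :=
  Complex.I • fderivT T = fM Q s h T * T - T * fM Q s h T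

/-- The component `X(a, b)(t) = (E_a ⊗ 1) X(t) (E_b ⊗ 1)` with fixed vertices `a`, `b`. -/
noncomputable def fvertex (Q : CoquasitriangularFaceHopfAlgebra ℂ V F) (a b : V)
    (X : PowerSeries (Conv ℂ F F)) : PowerSeries (Conv ℂ F F) :=
  PowerSeries.mk fun n => Q.vertex a b (PowerSeries.coeff n X)

end FormalTime

/-! ### Corepresentations and representations -/

/-- A matrix corepresentation: `Δ(T^A_B) = ∑ T^A_C ⊗ T^C_B` and `ε(T^A_B) = δ_{AB}`. -/
structure MatrixCorep (k F ι : Type*) [Field k] [Ring F] [Algebra k F] [Coalgebra k F]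
    [Fintype ι] [DecidableEq ι] where
  T : Matrix ι ι F
  comul_T : ∀ a b, comul (R := k) (T a b) = ∑ c, T a c ⊗ₜ[k] T c b
  counit_T : ∀ a b, counit (R := k) (T a b) = if a = b then 1 else 0

/-- An element `X` of `U ⊗ B` as a matrix with entries `X(T^A_B)` in `B`. -/
def MatrixCorep.eval {k F B ι : Type*} [Field k] [Ring F] [Algebra k F] [Coalgebra k F]
    [Ring B] [Algebra k B] [Fintype ι] [DecidableEq ι] (c : MatrixCorep k F ι)
    (X : Conv k F B) : Matrix ι ι B :=
  Matrix.of fun a b => X.ofConv (c.T a b)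

/-- The universal `T` in a representation `π : F → B`, as an element of `U ⊗ B`. -/
def repT {k F B : Type*} [Field k] [Ring F] [Algebra k F] [Ring B] [Algebra k B]
    (π : F →ₐ[k] B) : Conv k F B := toConv π.toLinearMap

/-- The component `X(a, b) = E_a X E_b` of a matrix with fixed vertices `a`, `b`. -/
noncomputable def MatrixCorep.vertex {k V F B ι : Type*} [Field k] [Fintype V] [DecidableEq V]
    [Ring F] [Algebra k F] [Coalgebra k F] [Ring B] [Algebra k B] [Fintype ι] [DecidableEq ι]
    (c : MatrixCorep k F ι) (Q : FaceAlgebra k V F) (a b : V) (X : Matrix ι ι B) :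
    Matrix ι ι B :=
  c.eval (tens (Q.ELo a) 1) * X * c.eval (tens (Q.ELo b) 1)

/-! ### Real time -/

section RealTime

variable {B : Type*} [NormedRing B] [NormedAlgebra ℂ B]

/-- The Heisenberg evolution `b(t) = exp(-i t H) b exp(i t H)` generated by `H`. -/
noncomputable def evolve (H : B) (t : ℝ) (b : B) : B :=
  NormedSpace.exp (-(Complex.I * (t : ℂ)) • H) * b * NormedSpace.exp ((Complex.I * (t : ℂ)) • H)

variable {V F ι : Type*} [Fintype V] [DecidableEq V] [Ring F] [Algebra ℂ F] [Coalgebra ℂ F]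
  [Fintype ι] [DecidableEq ι]

/-- The matrix of `M^±(t)`, `t ∈ ℝ`, in a matrix corepresentation `c` and a representation `π`
of `F`: the matrix of `M^±`, its entries evolved in time by the Hamiltonian `π(h)`. -/
noncomputable def evolveM (Q : CoquasitriangularFaceHopfAlgebra ℂ V F) (π : F →ₐ[ℂ] B)
    (c : MatrixCorep ℂ F ι) (s : Sgn) (h : F) (t : ℝ) : Matrix ι ι B :=
  (c.eval (Q.M s h (repT π))).map (evolve (π h) t)

end RealTime

end FaceLax

open FaceLax

/-!
Everything rests on one exchange relation and on the cyclicity of iterated coproducts of cocommutative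
elements. Let `R~` be the quasi-inverse of `R`. In the convolution algebra of maps `F ⊗ F → F` the
relation `R T₁ T₂ = T₂ T₁ R` yields `T₁ T₂ R~ = R~ T₂ T₁` and `T₁ T₂ = R~ T₂ T₁ R`;
although `R` is not invertible, `R~ R` and `R R~` act as units on `T₁ T₂` and `T₂ T₁`
(`Rtconv_mul_Rconv_mul_TT`, `TTop_mul_Rconv_mul_Rtconv`).

* At a pair of cocommutative elements a scalar form moves from one end of a product to the other,
  so `T₁ T₂ = R~ T₂ T₁ R` gives `a b = b a` (`mul_comm_of_isCocommutative`).
* One exchange relation evaluated at `h` in one factor says `[m_±, T] = 0` (`m_univT_commute`),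
  which is `[1 ⊗ h, T] = [M^±, T]`.
* Applying `R(a, ·)` to the exchange relation for `R~` is a Yang–Baxter relation (`yangBaxter`);
  combined with cyclicity it gives `[m_+, m_-] = 0` (`m_plus_m_minus_commute`).
* `R^±` are unital algebra maps (`Rpm_one`, `Rpm_mul`), so `U_± ⊗ B` is a subalgebra.

The rest uses only these commutation relations. The Heisenberg evolution of `T` is
`exp(-i t H) T exp(i t H)` with `H = 1 ⊗ h`, and `M^±(t)` is the same evolution of `M^±`; since
`m_±` commutes with `T`, conjugation by `g_± = exp(-i t H) exp(i t m_±)` produces the same `T(t)`,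
and `g_-⁻¹ g_+ = exp(-i t m_-) exp(i t m_+) = exp(i t (m_+ - m_-))`. Uniqueness of solutions makes
the Heisenberg and the Lax equations equivalent: by recursion on coefficients in formal time
(`formal_ode_unique`), by passing to the interaction picture in a Banach algebra
(`eq_evolve_of_lax`). Inserting `∑_c E_c E_c = 1` between factors gives the dynamical form.

For real time, evaluation on a matrix corepresentation is an algebra homomorphism from the
convolution algebra to matrices over `B`. That `g_±(t)` consists of elements of `U_± ⊗ B` follows
because the matrices of such elements form a closed subalgebra (`isClosed_map_UpmSubalgebra`).
-/

namespace FaceLax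

/-! ### Convolution algebras -/

lemma Conv.ext {k F B : Type*} [Field k] [Ring F] [Algebra k F] [Ring B] [Algebra k B]
    {X Y : Conv k F B} (h : ∀ f, X.ofConv f = Y.ofConv f) : X = Y :=
  WithConv.ext (LinearMap.ext h)

lemma tens_apply {k F B : Type*} [Field k] [Ring F] [Algebra k F] [Ring B] [Algebra k B]
    (u : Conv k F k) (b : B) (f : F) : (tens u b).ofConv f = u.ofConv f • b := rfl

section Convolution

variable {k F B B' : Type*} [Field k] [Ring F] [Algebra k F] [Coalgebra k F] [Ring B]
  [Algebra k B] [Ring B'] [Algebra k B']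

lemma oneTens_apply (b : B) (f : F) :
    (oneTens (k := k) b).ofConv f = counit (R := k) f • b := rfl

lemma conv_one_apply (f : F) : (1 : Conv k F B).ofConv f = counit (R := k) f • 1 :=
  Algebra.algebraMap_eq_smul_one _

lemma sum_counit_right_smul {ι : Type*} {f : F} (𝓡 : Coalgebra.Repr k f ι) :
    ∑ i ∈ 𝓡.index, counit (R := k) (𝓡.right i) • 𝓡.left i = f := by
  have H := congr(TensorProduct.rid k F $(sum_tmul_counit_eq 𝓡))
  rw [map_sum] at H
  simpa only [TensorProduct.rid_tmul, one_smul] using H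

lemma oneTens_mul_apply (b : B) (X : Conv k F B) (f : F) :
    (oneTens b * X).ofConv f = b * X.ofConv f := by
  have 𝓡 := ℛ k f
  rw [𝓡.convMul_apply]
  conv_rhs => rw [← sum_counit_smul 𝓡]
  simp [oneTens_apply, Finset.mul_sum]

lemma mul_oneTens_apply (b : B) (X : Conv k F B) (f : F) :
    (X * oneTens b).ofConv f = X.ofConv f * b := by
  have 𝓡 := ℛ k f
  rw [𝓡.convMul_apply]
  conv_rhs => rw [← sum_counit_right_smul 𝓡]
  simp [oneTens_apply, Finset.sum_mul]

lemma tens_mul_tens (u v : Conv k F k) (b c : B) :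
    tens u b * tens v c = tens (u * v) (b * c) := by
  refine Conv.ext fun f => ?_
  have 𝓡 := ℛ k f
  simp only [𝓡.convMul_apply, tens_apply, Finset.sum_smul]
  exact Finset.sum_congr rfl fun i _ => smul_mul_smul_comm _ _ _ _

lemma tens_one_one : tens (1 : Conv k F k) (1 : B) = 1 :=
  Conv.ext fun f => by
    rw [tens_apply, conv_one_apply, conv_one_apply, smul_eq_mul, mul_one]

/-- Convolution on `F ⊗ F`, in Sweedler components of the two factors. -/
lemma conv_mul_tmul_apply {ι κ : Type*} {a b : F} (𝓐 : Coalgebra.Repr k a ι)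
    (𝓑 : Coalgebra.Repr k b κ) (X Y : Conv k (F ⊗[k] F) B) :
    (X * Y).ofConv (a ⊗ₜ b) = ∑ i ∈ 𝓐.index, ∑ j ∈ 𝓑.index,
      X.ofConv (𝓐.left i ⊗ₜ 𝓑.left j) * Y.ofConv (𝓐.right i ⊗ₜ 𝓑.right j) := by
  rw [LinearMap.convMul_apply, TensorProduct.comul_tmul, ← 𝓐.eq, ← 𝓑.eq]
  simp [TensorProduct.sum_tmul, TensorProduct.tmul_sum]
  exact Finset.sum_comm

/-- Composition with an algebra homomorphism `B → B'`, as a homomorphism of convolution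
algebras. -/
def convMap (π : B →ₐ[k] B') : Conv k F B →+* Conv k F B' where
  toFun X := toConv (π.toLinearMap ∘ₗ X.ofConv)
  map_one' := Conv.ext fun f => by
    change π ((1 : Conv k F B).ofConv f) = (1 : Conv k F B').ofConv f
    simp
  map_mul' X Y := WithConv.ext (LinearMap.algHom_comp_convMul_distrib π X Y)
  map_zero' := Conv.ext fun f => by simp
  map_add' X Y := Conv.ext fun f => by simp

lemma convMap_apply (π : B →ₐ[k] B') (X : Conv k F B) (f : F) :
    (convMap π X).ofConv f = π (X.ofConv f) := rfl

lemma convMap_tens (π : B →ₐ[k] B') (u : Conv k F k) (b : B) :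
    convMap π (tens u b) = tens u (π b) :=
  Conv.ext fun f => by simp [convMap_apply, tens_apply]

end Convolution

/-! ### Cocommutative elements -/

section Cocommutative

variable {k F B B' : Type*} [Field k] [Ring F] [Algebra k F] [Coalgebra k F] [Ring B]
  [Algebra k B] [Ring B'] [Algebra k B']

/-- Sweedler components of a cocommutative element may be exchanged in bilinear expressions. -/
lemma IsCocommutative.sum_swap {M ι : Type*} [AddCommGroup M] [Module k M] {h : F}
    (hh : IsCocommutative k h) (𝓡 : Coalgebra.Repr k h ι) (β : F →ₗ[k] F →ₗ[k] M) :
    ∑ i ∈ 𝓡.index, β (𝓡.left i) (𝓡.right i) = ∑ i ∈ 𝓡.index, β (𝓡.right i) (𝓡.left i) := by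
  have H := congr(TensorProduct.lift β $hh)
  rw [← 𝓡.eq] at H
  simpa using H.symm

/-- At a cocommutative element, a convolution product is that of the opposite order as soon as
the values of the factors commute. -/
lemma IsCocommutative.conv_mul_apply_comm {h : F} (hh : IsCocommutative k h) {X Y : Conv k F B}
    (hXY : ∀ a b, Commute (X.ofConv a) (Y.ofConv b)) :
    (X * Y).ofConv h = (Y * X).ofConv h := by
  have 𝓡 := ℛ k h
  rw [𝓡.convMul_apply, 𝓡.convMul_apply]
  have := hh.sum_swap 𝓡 ((LinearMap.mul k B).compl₁₂ X.ofConv Y.ofConv)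
  simp only [LinearMap.compl₁₂_apply, LinearMap.mul_apply'] at this
  rw [this]
  exact Finset.sum_congr rfl fun i _ => hXY _ _

lemma IsCocommutative.tmul {a b : F} (ha : IsCocommutative k a) (hb : IsCocommutative k b) :
    IsCocommutative k (a ⊗ₜ[k] b) := by
  have 𝓐 := ℛ k a
  have 𝓑 := ℛ k b
  unfold IsCocommutative
  rw [TensorProduct.comul_tmul]
  conv_rhs => rw [← ha, ← hb]
  rw [← 𝓐.eq, ← 𝓑.eq]
  simp [TensorProduct.sum_tmul, TensorProduct.tmul_sum]

end Cocommutative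

/-! ### Contractions -/

section Contraction

variable {k F B B' : Type*} [Field k] [Ring F] [Algebra k F] [Coalgebra k F] [Ring B]
  [Algebra k B] [Ring B'] [Algebra k B']

lemma contraction_eq_sum {ι : Type*} (ρ : F →ₗ[k] Conv k F k) {h : F}
    (𝓡 : Coalgebra.Repr k h ι) (X : Conv k F B) :
    contraction ρ h X = ∑ i ∈ 𝓡.index, tens (ρ (𝓡.right i)) (X.ofConv (𝓡.left i)) := by
  refine Conv.ext fun f => ?_
  rw [contraction, ← 𝓡.eq]
  simp [tens_apply]

lemma contraction_oneTens_mul (ρ : F →ₗ[k] Conv k F k) (h : F) (b : B) (X : Conv k F B) :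
    contraction ρ h (oneTens b * X) = oneTens b * contraction ρ h X := by
  have 𝓡 := ℛ k h
  simp only [contraction_eq_sum ρ 𝓡, Finset.mul_sum, oneTens_mul_apply]
  simp [oneTens, tens_mul_tens]

lemma contraction_mul_oneTens (ρ : F →ₗ[k] Conv k F k) (h : F) (b : B) (X : Conv k F B) :
    contraction ρ h (X * oneTens b) = contraction ρ h X * oneTens b := by
  have 𝓡 := ℛ k h
  simp only [contraction_eq_sum ρ 𝓡, Finset.sum_mul, mul_oneTens_apply]
  simp [oneTens, tens_mul_tens]

lemma convMap_contraction (π : B →ₐ[k] B') (ρ : F →ₗ[k] Conv k F k) (h : F) (X : Conv k F B) :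
    convMap π (contraction ρ h X) = contraction ρ h (convMap π X) := by
  have 𝓡 := ℛ k h
  simp [contraction_eq_sum ρ 𝓡, convMap_tens, convMap_apply]

end Contraction

/-! ### Face algebras: fixed vertices -/

section Face

variable {k V F B : Type*} [Field k] [Fintype V] [DecidableEq V] [Ring F] [Algebra k F]
  [Coalgebra k F] [Ring B] [Algebra k B] (Q : FaceAlgebra k V F)

namespace FaceAlgebra

lemma eUp_eq_sum (i : V) : Q.eUp i = ∑ j, Q.eUp i * Q.eLo j := by
  rw [← Finset.mul_sum, Q.sum_eLo, mul_one]

lemma eLo_eq_sum (j : V) : Q.eLo j = ∑ i, Q.eUp i * Q.eLo j := by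
  rw [← Finset.sum_mul, Q.sum_eUp, one_mul]

lemma comul_eUp (i : V) :
    comul (R := k) (Q.eUp i) = ∑ l, (Q.eUp i * Q.eLo l) ⊗ₜ[k] Q.eUp l := by
  conv_lhs => rw [Q.eUp_eq_sum]
  simp only [map_sum, Q.comul_e]
  rw [Finset.sum_comm]
  exact Finset.sum_congr rfl fun l _ => by rw [← TensorProduct.tmul_sum, ← Q.eUp_eq_sum]

lemma comul_eLo (j : V) :
    comul (R := k) (Q.eLo j) = ∑ l, Q.eLo l ⊗ₜ[k] (Q.eUp l * Q.eLo j) := by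
  conv_lhs => rw [Q.eLo_eq_sum]
  simp only [map_sum, Q.comul_e]
  rw [Finset.sum_comm]
  exact Finset.sum_congr rfl fun l _ => by rw [← TensorProduct.sum_tmul, ← Q.eLo_eq_sum]

lemma comul_one : comul (R := k) (1 : F) = ∑ l, Q.eLo l ⊗ₜ[k] Q.eUp l := by
  rw [← Q.sum_eLo, map_sum]
  simp only [Q.comul_eLo]
  rw [Finset.sum_comm]
  exact Finset.sum_congr rfl fun l _ => by
    rw [← TensorProduct.tmul_sum, ← Q.eUp_eq_sum]

/-- The Sweedler components `e_l ⊗ e^l` of `Δ(1)`. -/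
noncomputable def reprOne : Coalgebra.Repr k (1 : F) V where
  index := Finset.univ
  left := Q.eLo
  right := Q.eUp
  eq := Q.comul_one.symm

lemma counit_mul_eUp_mul_eLo (f : F) (i j : V) :
    counit (R := k) (f * (Q.eUp i * Q.eLo j)) =
      if i = j then counit (R := k) (f * Q.eLo j) else 0 := by
  rw [Q.counit_mul]
  simp only [← mul_assoc, Q.eUp_mul_eUp, ite_mul, zero_mul, apply_ite (counit (R := k)), map_zero,
    Q.counit_e]
  simp
  split_ifs with h <;> simp [h]

lemma ELo_apply (i : V) (f : F) : (Q.ELo i).ofConv f = counit (R := k) (f * Q.eLo i) := rfl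

/-- `T (E_i ⊗ 1) = T (1 ⊗ e_i)`: expand the counit identity
`f e_i = (id ⊗ ε)(Δ(f) Δ(e_i))` and compare with `(id ⊗ E_i)(Δ(f) Δ(1))`. -/
lemma univT_mul_ELo (i : V) :
    univT k F * tens (Q.ELo i) 1 = toConv (LinearMap.mulRight k (Q.eLo i)) := by
  refine Conv.ext fun f => ?_
  have 𝓡 := ℛ k f
  have h1 := Q.comul_mul f 1
  have h2 := Q.comul_mul f (Q.eLo i)
  rw [mul_one, Q.comul_one] at h1
  rw [Q.comul_eLo] at h2
  rw [LinearMap.convMul_apply, h1, ← 𝓡.eq]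
  change _ = f * Q.eLo i
  have h3 := lTensor_counit_comul (R := k) (f * Q.eLo i)
  rw [h2, ← 𝓡.eq] at h3
  have h4 := congr(TensorProduct.rid k F $h3)
  rw [TensorProduct.rid_tmul, one_smul] at h4
  rw [← h4]
  simp [Finset.sum_mul, Finset.mul_sum, univT, tens_apply, ELo_apply, mul_assoc]

/-- `(E_i ⊗ 1) T = T (1 ⊗ e^i)`: expand the counit identity `f e^i = (ε ⊗ id)(Δ(f) Δ(e^i))` and
compare with `(E_i ⊗ id)(Δ(f) Δ(1))`. -/
lemma ELo_mul_univT (i : V) :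
    tens (Q.ELo i) 1 * univT k F = toConv (LinearMap.mulRight k (Q.eUp i)) := by
  refine Conv.ext fun f => ?_
  have 𝓡 := ℛ k f
  have h1 := Q.comul_mul f 1
  have h2 := Q.comul_mul f (Q.eUp i)
  rw [mul_one, Q.comul_one] at h1
  rw [Q.comul_eUp] at h2
  rw [LinearMap.convMul_apply, h1, ← 𝓡.eq]
  change _ = f * Q.eUp i
  have h3 := rTensor_counit_comul (R := k) (f * Q.eUp i)
  rw [h2, ← 𝓡.eq] at h3
  have h4 := congr(TensorProduct.lid k F $h3)
  rw [TensorProduct.lid_tmul, one_smul] at h4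
  rw [← h4]
  simp [Finset.sum_mul, Finset.mul_sum, univT, tens_apply, ELo_apply, mul_assoc, Q.eLo_mul_eLo,
    Q.counit_mul_eUp_mul_eLo, apply_ite (counit (R := k))]

lemma vertex_univT (a b : V) : Q.vertex a b (univT k F) = Q.vertexT a b := by
  rw [vertex, ELo_mul_univT]
  refine Conv.ext fun f => ?_
  have 𝓡 := ℛ k f
  have h := congr(($(Q.univT_mul_ELo b)).ofConv f)
  rw [𝓡.convMul_apply] at h ⊢
  change _ = f * (Q.eLo b * Q.eUp a)
  change _ = f * Q.eLo b at h
  rw [← mul_assoc, ← h, Finset.sum_mul]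
  exact Finset.sum_congr rfl fun i _ => by simp [tens_apply, univT]

lemma ELo_mul_ELo (i : V) : Q.ELo i * Q.ELo i = Q.ELo i := by
  refine Conv.ext fun f => ?_
  have 𝓡 := ℛ k f
  have h := congr(counit (R := k) (($(Q.univT_mul_ELo i)).ofConv f * Q.eLo i))
  rw [𝓡.convMul_apply] at h ⊢
  rw [Finset.sum_mul, map_sum] at h
  simp only [tens_apply, univT, LinearMap.mulRight_apply, LinearMap.id_apply, mul_smul_comm,
    mul_one, smul_mul_assoc, map_smul, smul_eq_mul, ELo_apply, mul_assoc, Q.eLo_mul_eLo,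
    if_true] at h ⊢
  rw [← h]
  exact Finset.sum_congr rfl fun i _ => mul_comm _ _

lemma sum_ELo : ∑ i, Q.ELo i = 1 := by
  refine Conv.ext fun f => ?_
  simp [ELo_apply, ← map_sum, ← Finset.mul_sum, Q.sum_eLo]

lemma sum_ELo_mul_ELo (B : Type*) [Ring B] [Algebra k B] :
    ∑ i, tens (Q.ELo i) (1 : B) * tens (Q.ELo i) (1 : B) = 1 := by
  simp only [tens_mul_tens, ELo_mul_ELo, mul_one]
  rw [← tens_one_one, ← Q.sum_ELo]
  exact Conv.ext fun f => by simp [tens_apply, Finset.sum_smul]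

end FaceAlgebra

end Face

namespace FaceAlgebra

variable {k V F B : Type*} [Field k] [Fintype V] [DecidableEq V] [Ring F] [Algebra k F]
  [Coalgebra k F] [Ring B] [Algebra k B]

/-- Restriction along the multiplication `F ⊗ F → F` is multiplicative on convolution
algebras. -/
lemma conv_mul_comp_mul' (Q : FaceAlgebra k V F) (X Y : Conv k F B) :
    toConv (X.ofConv ∘ₗ LinearMap.mul' k F) * toConv (Y.ofConv ∘ₗ LinearMap.mul' k F) =
      toConv ((X * Y).ofConv ∘ₗ LinearMap.mul' k F) := by
  refine WithConv.ext (TensorProduct.ext' fun a b => ?_)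
  have 𝓐 := ℛ k a
  have 𝓑 := ℛ k b
  rw [conv_mul_tmul_apply 𝓐 𝓑]
  simp only [LinearMap.comp_apply, LinearMap.mul'_apply]
  rw [LinearMap.convMul_apply, Q.comul_mul, ← 𝓐.eq, ← 𝓑.eq]
  simp [Finset.sum_mul, Finset.mul_sum]
  exact Finset.sum_comm

/-- Restriction along the opposite multiplication `F ⊗ F → F` is multiplicative on convolution
algebras. -/
lemma conv_mul_comp_mul'_comm (Q : FaceAlgebra k V F)
    (X Y : Conv k F B) :
    toConv (X.ofConv ∘ₗ LinearMap.mul' k F ∘ₗ (TensorProduct.comm k F F).toLinearMap) *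
        toConv (Y.ofConv ∘ₗ LinearMap.mul' k F ∘ₗ (TensorProduct.comm k F F).toLinearMap) =
      toConv ((X * Y).ofConv ∘ₗ LinearMap.mul' k F ∘ₗ
        (TensorProduct.comm k F F).toLinearMap) := by
  refine WithConv.ext (TensorProduct.ext' fun a b => ?_)
  have 𝓐 := ℛ k a
  have 𝓑 := ℛ k b
  rw [conv_mul_tmul_apply 𝓐 𝓑]
  simp only [LinearMap.comp_apply, LinearEquiv.coe_coe, TensorProduct.comm_tmul,
    LinearMap.mul'_apply]
  rw [LinearMap.convMul_apply, Q.comul_mul, ← 𝓐.eq, ← 𝓑.eq]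
  simp [Finset.sum_mul, Finset.mul_sum]

lemma isCocommutative_mul (Q : FaceAlgebra k V F) {a b : F}
    (ha : IsCocommutative k a) (hb : IsCocommutative k b) :
    IsCocommutative k (a * b) := by
  unfold IsCocommutative at *
  rw [Q.comul_mul, ← Algebra.TensorProduct.comm_toLinearEquiv k]
  simp only [AlgEquiv.coe_toLinearEquiv, map_mul]
  change TensorProduct.comm k F F _ * TensorProduct.comm k F F _ = _
  rw [ha, hb]

end FaceAlgebra

/-! ### The universal `R`-form -/

section RForm

variable {k F : Type*} [Field k] [Ring F] [Algebra k F]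

lemma pairFst_apply (R : F ⊗[k] F →ₗ[k] k) (a b : F) :
    (pairFst R a).ofConv b = R (a ⊗ₜ b) := rfl

lemma pairSnd_apply (R : F ⊗[k] F →ₗ[k] k) (a b : F) :
    (pairSnd R b).ofConv a = R (a ⊗ₜ b) := rfl

/-- `T₁ T₂`, the map `a ⊗ b ↦ a b`. -/
noncomputable def TT (k F : Type*) [Field k] [Ring F] [Algebra k F] : Conv k (F ⊗[k] F) F :=
  toConv (LinearMap.mul' k F)

/-- `T₂ T₁`, the map `a ⊗ b ↦ b a`. -/
noncomputable def TTop (k F : Type*) [Field k] [Ring F] [Algebra k F] : Conv k (F ⊗[k] F) F :=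
  toConv (LinearMap.mul' k F ∘ₗ (TensorProduct.comm k F F).toLinearMap)

lemma TT_apply (a b : F) : (TT k F).ofConv (a ⊗ₜ b) = a * b := rfl

lemma TTop_apply (a b : F) : (TTop k F).ofConv (a ⊗ₜ b) = b * a := rfl

end RForm

namespace CoquasitriangularFaceHopfAlgebra

variable {k V F B : Type*} [Field k] [Fintype V] [DecidableEq V] [Ring F] [Algebra k F]
  [Coalgebra k F] [Ring B] [Algebra k B] (Q : CoquasitriangularFaceHopfAlgebra k V F)

lemma Rtilde_tmul (a b : F) : Q.Rtilde (a ⊗ₜ b) = Q.R (Q.S a ⊗ₜ b) := rfl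

/-- The form `R` as an element of the convolution algebra of maps `F ⊗ F → F`. -/
noncomputable def Rconv : Conv k (F ⊗[k] F) F := tens (toConv Q.R) 1

/-- The form `R~` as an element of the convolution algebra of maps `F ⊗ F → F`. -/
noncomputable def Rtconv : Conv k (F ⊗[k] F) F := tens (toConv Q.Rtilde) 1

lemma Rconv_mul_TT : Q.Rconv * TT k F = TTop k F * Q.Rconv := Q.RTT

lemma tens_counit_comp (G : F ⊗[k] F →ₗ[k] F) :
    tens (toConv (counit (R := k) ∘ₗ G)) (1 : B) = toConv ((1 : Conv k F B).ofConv ∘ₗ G) := by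
  refine Conv.ext fun x => ?_
  exact (conv_one_apply (G x)).symm

/-- `R~ R` acts as the identity on `T₁ T₂`, because `ε(a₁ b₁) a₂ b₂ = a b`. -/
lemma Rtconv_mul_Rconv_mul_TT : Q.Rtconv * (Q.Rconv * TT k F) = TT k F := by
  rw [← mul_assoc, Rtconv, Rconv, tens_mul_tens, Rtilde, Q.Rtilde_mul_R, mul_one,
    tens_counit_comp]
  exact (Q.conv_mul_comp_mul' 1 (univT k F)).trans (by rw [one_mul]; rfl)

/-- `R R~` acts as the identity on `T₂ T₁`, because `b₁ a₁ ε(b₂ a₂) = b a`. -/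
lemma TTop_mul_Rconv_mul_Rtconv : TTop k F * (Q.Rconv * Q.Rtconv) = TTop k F := by
  rw [Rtconv, Rconv, tens_mul_tens, Rtilde, Q.R_mul_Rtilde, mul_one, tens_counit_comp]
  exact (Q.conv_mul_comp_mul'_comm (univT k F) 1).trans (by rw [mul_one]; rfl)

lemma Rconv_mul_Rtconv_mul_TTop : Q.Rconv * (Q.Rtconv * TTop k F) = TTop k F := by
  rw [← mul_assoc, Rtconv, Rconv, tens_mul_tens, Rtilde, Q.R_mul_Rtilde, mul_one,
    tens_counit_comp]
  exact (Q.conv_mul_comp_mul'_comm 1 (univT k F)).trans (by rw [one_mul]; rfl)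

lemma TT_eq : TT k F = Q.Rtconv * (TTop k F * Q.Rconv) := by
  rw [← Rconv_mul_TT, Rtconv_mul_Rconv_mul_TT]

/-- The exchange relation for `R~`: `∑ a₁ b₁ R~(a₂,b₂) = ∑ R~(a₁,b₁) b₂ a₂`. -/
lemma TT_mul_Rtconv : TT k F * Q.Rtconv = Q.Rtconv * TTop k F := by
  rw [Q.TT_eq, mul_assoc, mul_assoc, TTop_mul_Rconv_mul_Rtconv]

/-- A scalar form on `F ⊗ F` may be moved cyclically through a product evaluated at a
cocommutative element. -/
lemma tens_one_mul_apply_comm {C : Type*} [Ring C] [Algebra k C] [Coalgebra k C] {x : C}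
    (hx : IsCocommutative k x) (φ : Conv k C k) (X : Conv k C B) :
    (tens φ 1 * X).ofConv x = (X * tens φ 1).ofConv x :=
  hx.conv_mul_apply_comm fun a b => by
    rw [tens_apply]
    exact (Commute.one_left _).smul_left _

/-- Cocommutative elements commute: `a b = R~(a₁,b₁) b₂ a₂ R(a₃,b₃)`, and moving `R~` cyclically
to the end cancels it against `R`. -/
lemma mul_comm_of_isCocommutative (Q : CoquasitriangularFaceHopfAlgebra k V F) {a b : F}
    (ha : IsCocommutative k a) (hb : IsCocommutative k b) : a * b = b * a := by
  rw [← TT_apply (k := k), ← TTop_apply (k := k), Q.TT_eq, Rtconv,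
    tens_one_mul_apply_comm (ha.tmul hb), mul_assoc]
  change (TTop k F * (Q.Rconv * Q.Rtconv)).ofConv _ = _
  rw [TTop_mul_Rconv_mul_Rtconv]

/-- The cocommutative elements, as a non-unital subalgebra. -/
def cocommutativeSubalgebra : NonUnitalSubalgebra k F where
  carrier := {f | IsCocommutative k f}
  zero_mem' := by simp [IsCocommutative]
  add_mem' ha hb := by
    simp only [Set.mem_ofPred_eq, IsCocommutative, map_add] at *
    rw [ha, hb]
  smul_mem' c a ha := by
    simp only [Set.mem_ofPred_eq, IsCocommutative, map_smul] at *
    rw [ha]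
  mul_mem' ha hb := Q.isCocommutative_mul ha hb

/-! ### The subalgebras `U_±` -/

/-- `R(1, ·) = ε`: the product `R~ R` at `1 ⊗ b` exhibits `ε` as a sum of products ending in
`R(e^l, ·)`, and each of these absorbs `R(1, ·)` on the right. -/
lemma pairFst_R_one : pairFst Q.R 1 = 1 := by
  have h : ∑ l, pairFst Q.R (Q.S (Q.eLo l)) * pairFst Q.R (Q.eUp l) = 1 := by
    refine Conv.ext fun b => ?_
    have 𝓑 := ℛ k b
    have H := congr(($Q.Rtilde_mul_R).ofConv (1 ⊗ₜ b))
    rw [conv_mul_tmul_apply Q.reprOne 𝓑] at H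
    simp only [ofConv_sum, LinearMap.sum_apply, 𝓑.convMul_apply, pairFst_apply]
    refine H.trans ?_
    simp
  rw [← one_mul (pairFst Q.R 1), ← h, Finset.sum_mul]
  simp only [← Q.R_mul_left, mul_one]

/-- `R(·, 1) = ε`, by the same argument with `R~ R` at `a ⊗ 1`. -/
lemma pairSnd_R_one : pairSnd Q.R 1 = 1 := by
  have h : ∑ l, pairSnd Q.Rtilde (Q.eLo l) * pairSnd Q.R (Q.eUp l) = 1 := by
    refine Conv.ext fun a => ?_
    have 𝓐 := ℛ k a
    have H := congr(($Q.Rtilde_mul_R).ofConv (a ⊗ₜ 1))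
    rw [conv_mul_tmul_apply 𝓐 Q.reprOne, Finset.sum_comm] at H
    simp only [ofConv_sum, LinearMap.sum_apply, 𝓐.convMul_apply, pairSnd_apply]
    refine H.trans ?_
    simp
  rw [← one_mul (pairSnd Q.R 1), ← h, Finset.sum_mul]
  simp only [mul_assoc, ← Q.R_mul_right, one_mul]

lemma Rpm_one (s : Sgn) : Q.Rpm s 1 = 1 := by
  cases s with
  | plus => exact Q.pairFst_R_one
  | minus =>
    refine Conv.ext fun f => ?_
    change (pairSnd Q.R 1).ofConv (Q.S f) = _
    rw [pairSnd_R_one, conv_one_apply, conv_one_apply, Q.counit_S]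

/-- `R^±` is multiplicative. For `R^-` the two reversals, in `(id ⊗ Δ)(R) = R₁₃ R₁₂` and in the
coproduct of `S`, compensate each other. -/
lemma Rpm_mul (s : Sgn) (a b : F) : Q.Rpm s (a * b) = Q.Rpm s a * Q.Rpm s b := by
  cases s with
  | plus => exact Q.R_mul_left a b
  | minus =>
    refine Conv.ext fun f => ?_
    have 𝓡 := ℛ k f
    change (pairSnd Q.R (a * b)).ofConv (Q.S f) = (pairSnd Q.Rtilde a * pairSnd Q.Rtilde b).ofConv f
    rw [Q.R_mul_right, LinearMap.convMul_apply, Q.comul_S, 𝓡.convMul_apply, ← 𝓡.eq]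
    simp [pairSnd_apply, Rtilde_tmul, mul_comm]

variable (B) in
/-- `U_± ⊗ B` is a subalgebra. -/
noncomputable def UpmSubalgebra (s : Sgn) : Subalgebra k (Conv k F B) :=
  (Q.UpmTensor B s).toSubalgebra
    (Submodule.subset_span ⟨1, ⟨1, Q.Rpm_one s⟩, 1, tens_one_one.symm⟩)
    fun x y hx hy => by
      induction hx using Submodule.span_induction with
      | zero => simp
      | add x₁ x₂ _ _ h₁ h₂ => rw [add_mul]; exact add_mem h₁ h₂
      | smul r x _ h => rw [smul_mul_assoc]; exact Submodule.smul_mem _ _ h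
      | mem x hx =>
        obtain ⟨_, ⟨f, rfl⟩, b, rfl⟩ := hx
        induction hy using Submodule.span_induction with
        | zero => simp
        | add x₁ x₂ _ _ h₁ h₂ => rw [mul_add]; exact add_mem h₁ h₂
        | smul r x _ h => rw [mul_smul_comm]; exact Submodule.smul_mem _ _ h
        | mem x hx =>
          obtain ⟨_, ⟨g, rfl⟩, c, rfl⟩ := hx
          rw [tens_mul_tens, ← Rpm_mul]
          exact Submodule.subset_span ⟨_, ⟨_, rfl⟩, _, rfl⟩

lemma oneTens_mem_UpmSubalgebra (s : Sgn) (b : B) : oneTens b ∈ Q.UpmSubalgebra B s :=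
  Submodule.subset_span ⟨1, ⟨1, Q.Rpm_one s⟩, b, rfl⟩

lemma m_mem_UpmSubalgebra (s : Sgn) (h : F) (X : Conv k F B) :
    Q.m s h X ∈ Q.UpmSubalgebra B s := by
  have 𝓡 := ℛ k h
  rw [m, contraction_eq_sum _ 𝓡]
  exact sum_mem fun i _ => Submodule.subset_span ⟨_, ⟨_, rfl⟩, _, rfl⟩

lemma M_mem_UpmSubalgebra (s : Sgn) (h : F) (X : Conv k F B) :
    Q.M s h X ∈ Q.UpmSubalgebra B s :=
  sub_mem (Q.oneTens_mem_UpmSubalgebra s _) (Q.m_mem_UpmSubalgebra s h X)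

/-! ### Commutation relations -/

/-- `[m_±, T] = 0`: the relation `R T₁ T₂ = T₂ T₁ R`, respectively `T₁ T₂ R~ = R~ T₂ T₁`, evaluated
in one factor at the cocommutative element `h`. -/
lemma m_univT_commute (s : Sgn) {h : F} (hh : IsCocommutative k h) :
    Commute (Q.m s h (univT k F)) (univT k F) := by
  refine Conv.ext fun f => ?_
  have 𝓗 := ℛ k h
  have 𝓕 := ℛ k f
  rw [m, contraction_eq_sum _ 𝓗, Finset.sum_mul, Finset.mul_sum]
  simp only [ofConv_sum, LinearMap.sum_apply, 𝓕.convMul_apply, tens_apply]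
  cases s with
  | plus =>
    have H := congr(($(Q.Rconv_mul_TT)).ofConv (h ⊗ₜ f))
    rw [conv_mul_tmul_apply 𝓗 𝓕, conv_mul_tmul_apply 𝓗 𝓕] at H
    refine Eq.trans ?_ (H.trans ?_)
    · rw [Finset.sum_comm]
      conv_rhs => rw [Finset.sum_comm]
      refine Finset.sum_congr rfl fun j _ => ?_
      have := hh.sum_swap 𝓗 (((LinearMap.mul k F).compl₁₂
        ((pairSnd Q.R (𝓕.left j)).ofConv.smulRight 1) (LinearMap.mulRight k (𝓕.right j))))
      simpa [Rconv, tens_apply, TT_apply, univT, Rpm, pairFst_apply, pairSnd_apply] using this.symm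
    · simp [Rconv, tens_apply, TTop_apply, univT, Rpm, pairFst_apply]
  | minus =>
    have H := congr(($(Q.TT_mul_Rtconv)).ofConv (f ⊗ₜ h))
    rw [conv_mul_tmul_apply 𝓕 𝓗, conv_mul_tmul_apply 𝓕 𝓗] at H
    refine Eq.trans ?_ (H.symm.trans ?_)
    · rw [Finset.sum_comm]
      refine Finset.sum_congr rfl fun j _ => ?_
      have := hh.sum_swap 𝓗 (((LinearMap.mul k F).compl₁₂
        ((pairFst Q.Rtilde (𝓕.left j)).ofConv.smulRight 1) (LinearMap.mulRight k (𝓕.right j))))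
      simpa [Rtconv, tens_apply, TTop_apply, univT, Rpm, pairFst_apply, pairSnd_apply]
        using this.symm
    · rw [Finset.sum_comm]
      simp [Rtconv, tens_apply, TT_apply, univT, Rpm, pairSnd_apply]

/-- For a bilinear `φ : F → F → U`, the form `a ⊗ b ↦ φ(a, b)(f)` on `F ⊗ F`. -/
noncomputable def formAt (φ : F →ₗ[k] F →ₗ[k] Conv k F k) (f : F) : Conv k (F ⊗[k] F) k :=
  toConv (LinearMap.applyₗ f ∘ₗ (WithConv.linearEquiv k (F →ₗ[k] k)).toLinearMap ∘ₗ
    TensorProduct.lift φ)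

/-- `a ⊗ b ↦ R⁺(a) R⁻(b)`. -/
noncomputable def RplusRminus : F →ₗ[k] F →ₗ[k] Conv k F k :=
  (LinearMap.mul k (Conv k F k)).compl₁₂ (Q.Rpm .plus) (Q.Rpm .minus)

/-- `a ⊗ b ↦ R⁻(b) R⁺(a)`. -/
noncomputable def RminusRplus : F →ₗ[k] F →ₗ[k] Conv k F k :=
  ((LinearMap.mul k (Conv k F k)).compl₁₂ (Q.Rpm .minus) (Q.Rpm .plus)).flip

/-- The Yang–Baxter relation `R₁₂ R⁺₁ R⁻₂ = R⁻₂ R⁺₁ R₁₂`: apply `R(a, ·)` to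
`∑ f₁ b₁ R~(f₂,b₂) = ∑ R~(f₁,b₁) b₂ f₂`. -/
lemma yangBaxter (f : F) :
    toConv Q.R * formAt Q.RplusRminus f = formAt Q.RminusRplus f * toConv Q.R := by
  refine WithConv.ext (TensorProduct.ext' fun a b => ?_)
  have 𝓐 := ℛ k a
  have 𝓑 := ℛ k b
  have 𝓕 := ℛ k f
  rw [conv_mul_tmul_apply 𝓐 𝓑, conv_mul_tmul_apply 𝓐 𝓑]
  have H := congr((pairFst Q.R a).ofConv (($(Q.TT_mul_Rtconv)).ofConv (f ⊗ₜ b)))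
  rw [conv_mul_tmul_apply 𝓕 𝓑, conv_mul_tmul_apply 𝓕 𝓑] at H
  have hR : ∀ x y : F, (pairFst Q.R a).ofConv (x * y) = ∑ i ∈ 𝓐.index,
      Q.R (𝓐.left i ⊗ₜ y) * Q.R (𝓐.right i ⊗ₜ x) := fun x y => by
    change (pairSnd Q.R (x * y)).ofConv a = _
    rw [Q.R_mul_right, 𝓐.convMul_apply]
    rfl
  simp only [map_sum, Rtconv, tens_apply, TT_apply, TTop_apply, mul_smul_comm, mul_one,
    smul_mul_assoc, one_mul, map_smul, hR, smul_eq_mul, Finset.mul_sum] at H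
  have e1 : ∀ x y : F, (formAt Q.RplusRminus f).ofConv (x ⊗ₜ y) = ∑ l ∈ 𝓕.index,
      Q.R (x ⊗ₜ 𝓕.left l) * Q.Rtilde (𝓕.right l ⊗ₜ y) := fun x y => by
    change (Q.Rpm .plus x * Q.Rpm .minus y).ofConv f = _
    rw [𝓕.convMul_apply]; rfl
  have e2 : ∀ x y : F, (formAt Q.RminusRplus f).ofConv (x ⊗ₜ y) = ∑ l ∈ 𝓕.index,
      Q.Rtilde (𝓕.left l ⊗ₜ y) * Q.R (x ⊗ₜ 𝓕.right l) := fun x y => by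
    change (Q.Rpm .minus y * Q.Rpm .plus x).ofConv f = _
    rw [𝓕.convMul_apply]; rfl
  simp only [e1, e2, Finset.mul_sum, Finset.sum_mul]
  have swap (g : _ → _ → _ → k) : ∑ l ∈ 𝓕.index, ∑ j ∈ 𝓑.index, ∑ i ∈ 𝓐.index, g l j i =
      ∑ i ∈ 𝓐.index, ∑ j ∈ 𝓑.index, ∑ l ∈ 𝓕.index, g l j i :=
    (Finset.sum_comm.trans (Finset.sum_congr rfl fun j _ => Finset.sum_comm)).trans
      Finset.sum_comm
  rw [swap, swap] at H
  refine Eq.trans ?_ (H.trans ?_) <;>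
  · refine Finset.sum_congr rfl fun i _ => Finset.sum_congr rfl fun j _ =>
      Finset.sum_congr rfl fun l _ => ?_
    ring

/-- `[m_+, m_-] = 0`: by the Yang–Baxter relation, `T₁ T₂ R⁺₁ R⁻₂` and `T₂ T₁ R⁻₂ R⁺₁` agree
at a pair of cocommutative elements. -/
lemma m_plus_m_minus_commute {h : F} (hh : IsCocommutative k h) :
    Commute (Q.m .plus h (univT k F)) (Q.m .minus h (univT k F)) := by
  refine Conv.ext fun f => ?_
  have 𝓗 := ℛ k h
  have e1 : (Q.m .plus h (univT k F) * Q.m .minus h (univT k F)).ofConv f =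
      (TT k F * tens (formAt Q.RplusRminus f) 1).ofConv (h ⊗ₜ h) := by
    rw [m, m, contraction_eq_sum _ 𝓗, contraction_eq_sum _ 𝓗, conv_mul_tmul_apply 𝓗 𝓗,
      Finset.sum_mul_sum]
    simp only [ofConv_sum, LinearMap.sum_apply, tens_mul_tens, tens_apply, mul_smul_comm, mul_one]
    rfl
  have e2 : (Q.m .minus h (univT k F) * Q.m .plus h (univT k F)).ofConv f =
      (TTop k F * tens (formAt Q.RminusRplus f) 1).ofConv (h ⊗ₜ h) := by
    rw [m, m, contraction_eq_sum _ 𝓗, contraction_eq_sum _ 𝓗, conv_mul_tmul_apply 𝓗 𝓗,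
      Finset.sum_mul_sum, Finset.sum_comm]
    simp only [ofConv_sum, LinearMap.sum_apply, tens_mul_tens, tens_apply, mul_smul_comm, mul_one]
    rfl
  have yb : Q.Rconv * tens (formAt Q.RplusRminus f) 1 =
      tens (formAt Q.RminusRplus f) 1 * Q.Rconv := by
    simp only [Rconv, tens_mul_tens, yangBaxter]
  rw [e1, e2, Q.TT_eq]
  calc (Q.Rtconv * (TTop k F * Q.Rconv) * tens (formAt Q.RplusRminus f) 1).ofConv (h ⊗ₜ h)
      = (Q.Rtconv * (TTop k F * tens (formAt Q.RminusRplus f) 1) * Q.Rconv).ofConv (h ⊗ₜ h) := by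
        simp only [mul_assoc, yb]
    _ = (Q.Rconv * (Q.Rtconv * (TTop k F * tens (formAt Q.RminusRplus f) 1))).ofConv
          (h ⊗ₜ h) := (tens_one_mul_apply_comm (hh.tmul hh) _ _).symm
    _ = _ := by
        simp only [← mul_assoc]
        rw [mul_assoc Q.Rconv, Rconv_mul_Rtconv_mul_TTop]

/-! ### Lax operators in representations -/

section Representation

variable {B' : Type*} [Ring B'] [Algebra k B']

lemma convMap_m (π : B →ₐ[k] B') (s : Sgn) (h : F) (X : Conv k F B) :
    convMap π (Q.m s h X) = Q.m s h (convMap π X) := convMap_contraction π _ h X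

lemma m_repT_commute (π : F →ₐ[k] B) (s : Sgn) {h : F} (hh : IsCocommutative k h) :
    Commute (Q.m s h (repT π)) (repT π) := by
  have H := (Q.m_univT_commute s hh).map (convMap π)
  rwa [convMap_m] at H

lemma m_plus_m_minus_repT_commute (π : F →ₐ[k] B) {h : F} (hh : IsCocommutative k h) :
    Commute (Q.m .plus h (repT π)) (Q.m .minus h (repT π)) := by
  have H := (Q.m_plus_m_minus_commute hh).map (convMap π)
  rwa [convMap_m, convMap_m] at H

lemma M_repT (π : F →ₐ[k] B) (s : Sgn) (h : F) :
    Q.M s h (repT π) = oneTens (π h) - Q.m s h (repT π) := rfl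

lemma M_univT (s : Sgn) (h : F) :
    Q.M s h (univT k F) = oneTens h - Q.m s h (univT k F) := rfl

lemma M_oneTens_mul (s : Sgn) (h : F) (b : B) (X : Conv k F B) :
    Q.M s h (oneTens b * X) = oneTens b * Q.M s h X := by
  rw [M, M, m, m, contraction_oneTens_mul, oneTens_mul_apply, mul_sub, oneTens, oneTens, oneTens,
    tens_mul_tens, one_mul]

lemma M_mul_oneTens (s : Sgn) (h : F) (b : B) (X : Conv k F B) :
    Q.M s h (X * oneTens b) = Q.M s h X * oneTens b := by
  rw [M, M, m, m, contraction_mul_oneTens, mul_oneTens_apply, sub_mul, oneTens, oneTens, oneTens,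
    tens_mul_tens, one_mul]

/-- `X ↦ 1 ⊗ X(h) - R^±(h₂) ⊗ X(h₁)` as a linear map. -/
noncomputable def Mlin (s : Sgn) (h : F) : Conv k F B →ₗ[k] Conv k F B where
  toFun := Q.M s h
  map_add' X Y := by
    have 𝓗 := ℛ k h
    refine Conv.ext fun f => ?_
    simp [M, m, contraction_eq_sum _ 𝓗, tens_apply, oneTens_apply, Finset.sum_add_distrib]
    abel
  map_smul' c X := by
    have 𝓗 := ℛ k h
    refine Conv.ext fun f => ?_
    simp [M, m, contraction_eq_sum _ 𝓗, tens_apply, oneTens_apply, smul_sub, Finset.smul_sum,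
      smul_comm c]

lemma Mlin_apply (s : Sgn) (h : F) (X : Conv k F B) : Q.Mlin s h X = Q.M s h X := rfl

end Representation

end CoquasitriangularFaceHopfAlgebra

/-! ### Matrix corepresentations -/

namespace MatrixCorep

variable {k V F B ι : Type*} [Field k] [Fintype V] [DecidableEq V] [Ring F] [Algebra k F]
  [Coalgebra k F] [Ring B] [Algebra k B] [Fintype ι] [DecidableEq ι] (c : MatrixCorep k F ι)

variable (B) in
/-- Evaluation on the matrix elements of a corepresentation turns convolution into the product of
matrices. -/
noncomputable def evalHom : Conv k F B →ₐ[k] Matrix ι ι B :=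
  AlgHom.ofLinearMap
    { toFun := c.eval
      map_add' := fun _ _ => rfl
      map_smul' := fun _ _ => rfl }
    (by
      ext a b
      change (1 : Conv k F B).ofConv (c.T a b) = _
      rw [conv_one_apply, c.counit_T, Matrix.one_apply]
      simp)
    (fun X Y => by
      ext a b
      change (X * Y).ofConv (c.T a b) = _
      rw [LinearMap.convMul_apply, c.comul_T]
      simp [Matrix.mul_apply]
      rfl)

lemma evalHom_apply (X : Conv k F B) : c.evalHom B X = c.eval X := rfl

lemma eval_oneTens (b : B) : c.eval (oneTens b) = Matrix.scalar ι b := by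
  ext i j
  simp [eval, oneTens_apply, c.counit_T, Matrix.diagonal_apply]

/-- Summation over the intermediate vertex, by `∑_d E_d E_d = 1`. -/
lemma sum_vertex_mul_vertex (Q : FaceAlgebra k V F) (a b : V) (X Y : Matrix ι ι B) :
    ∑ d, c.vertex Q a d X * c.vertex Q d b Y = c.vertex Q a b (X * Y) := by
  have h := congr(c.evalHom B $(Q.sum_ELo_mul_ELo B))
  simp only [map_sum, map_mul, map_one, evalHom_apply] at h
  calc _ = ∑ d, c.eval (tens (Q.ELo a) 1) * X *
        (c.eval (tens (Q.ELo d) 1) * c.eval (tens (Q.ELo d) 1)) *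
          (Y * c.eval (tens (Q.ELo b) 1)) :=
        Finset.sum_congr rfl fun d _ => by simp only [vertex, mul_assoc]
    _ = _ := by rw [← Finset.sum_mul, ← Finset.mul_sum, h, mul_one, vertex]; simp only [mul_assoc]

lemma vertex_sub (Q : FaceAlgebra k V F) (a b : V) (X Y : Matrix ι ι B) :
    c.vertex Q a b (X - Y) = c.vertex Q a b X - c.vertex Q a b Y := by
  simp only [vertex, mul_sub, sub_mul]

lemma vertex_lie (Q : FaceAlgebra k V F) (a b : V) (X Y : Matrix ι ι B) :
    ∑ d, (c.vertex Q a d X * c.vertex Q d b Y - c.vertex Q a d Y * c.vertex Q d b X) =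
      c.vertex Q a b (X * Y - Y * X) := by
  rw [Finset.sum_sub_distrib, sum_vertex_mul_vertex, sum_vertex_mul_vertex, vertex_sub]

/-- The Sweedler components of the trace of a corepresentation. -/
noncomputable def reprTrace : Coalgebra.Repr k c.T.trace (ι × ι) where
  index := Finset.univ
  left p := c.T p.1 p.2
  right p := c.T p.2 p.1
  eq := by simp [Matrix.trace, Fintype.sum_prod_type, c.comul_T]

lemma isCocommutative_trace : IsCocommutative k c.T.trace := by
  unfold IsCocommutative
  simp only [Matrix.trace, Matrix.diag, map_sum, c.comul_T, TensorProduct.comm_tmul]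
  exact Finset.sum_comm

lemma eval_M_trace {κ : Type*} [Fintype κ] [DecidableEq κ]
    (Q : CoquasitriangularFaceHopfAlgebra k V F) (c' : MatrixCorep k F κ) (π : F →ₐ[k] B)
    (s : Sgn) (a b : ι) :
    c.eval (Q.M s c'.T.trace (repT π)) a b = (if a = b then π c'.T.trace else 0) -
      ∑ i, ∑ j, (Q.Rpm s (c'.T j i)).ofConv (c.T a b) • π (c'.T i j) := by
  rw [Q.M_repT, CoquasitriangularFaceHopfAlgebra.m, contraction_eq_sum _ c'.reprTrace]
  simp [eval, oneTens_apply, c.counit_T, tens_apply, reprTrace, repT, Fintype.sum_prod_type]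

lemma eval_M_repT (Q : CoquasitriangularFaceHopfAlgebra k V F) (π : F →ₐ[k] B) (s : Sgn)
    (h : F) : c.eval (Q.M s h (repT π)) = Matrix.scalar ι (π h) - c.eval (Q.m s h (repT π)) := by
  rw [Q.M_repT, ← c.eval_oneTens]
  rfl

/-- The matrices of the elements of `U_± ⊗ B` form a closed set: they are cut out by a projection
of `Mat(k)` onto the finite-dimensional space of matrices of elements of `U_±`. -/
lemma isClosed_map_UpmSubalgebra [TopologicalSpace B] [IsTopologicalAddGroup B]
    [ContinuousConstSMul k B] [T2Space B] (Q : CoquasitriangularFaceHopfAlgebra k V F)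
    (s : Sgn) : IsClosed ((Q.UpmSubalgebra B s).map (c.evalHom B) : Set (Matrix ι ι B)) := by
  set W : Submodule k (Matrix ι ι k) := (Q.Upm s).map (c.evalHom k).toLinearMap with hW
  obtain ⟨P, hP⟩ := W.subtype.exists_leftInverse_of_injective W.ker_subtype
  have hP' : ∀ w ∈ W, (P w : Matrix ι ι k) = w := fun w hw =>
    congr(($(LinearMap.congr_fun hP ⟨w, hw⟩) : Matrix ι ι k))
  -- the extension of `P` to `Mat(B) = Mat(k) ⊗ B`
  let Φ : Matrix ι ι B → Matrix ι ι B := fun X =>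
    ∑ i, ∑ j, (P (Matrix.single i j 1) : Matrix ι ι k).map (· • X i j)
  have hadd : ∀ X Y, Φ (X + Y) = Φ X + Φ Y := fun X Y => by
    ext p q
    simp [Φ, Matrix.sum_apply, smul_add, Finset.sum_add_distrib]
  have hsmul : ∀ (r : k) X, Φ (r • X) = r • Φ X := fun r X => by
    ext p q
    simp [Φ, Matrix.sum_apply, Finset.smul_sum, smul_comm r]
  have hΦ_mem : ∀ X, Φ X ∈ (Q.UpmSubalgebra B s).map (c.evalHom B) := fun X =>
    sum_mem fun i _ => sum_mem fun j _ => by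
      obtain ⟨u, hu, hu'⟩ := (P (Matrix.single i j 1)).2
      exact ⟨tens u (X i j), Submodule.subset_span ⟨u, hu, _, rfl⟩, by rw [← hu']; rfl⟩
  have hΦ_tens : ∀ u ∈ Q.Upm s, ∀ b : B, Φ (c.eval (tens u b)) = c.eval (tens u b) := by
    intro u hu b
    have hw := hP' (c.evalHom k u) ⟨u, hu, rfl⟩
    conv_lhs at hw => rw [Matrix.matrix_eq_sum_single (c.evalHom k u)]
    ext p q
    have hpq := congr($hw p q • b)
    rw [evalHom_apply] at hpq
    refine Eq.trans ?_ hpq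
    have hs : ∀ i j, Matrix.single i j (c.eval u i j) =
        c.eval u i j • Matrix.single i j (1 : k) := fun i j => by simp
    simp only [map_sum, hs, map_smul, Φ, Matrix.sum_apply, Submodule.coe_sum,
      Submodule.coe_smul, Matrix.smul_apply, Finset.sum_smul, Matrix.map_apply, smul_eq_mul]
    refine Finset.sum_congr rfl fun i _ => Finset.sum_congr rfl fun j _ => ?_
    rw [mul_comm, mul_smul]
    rfl
  have hΦ : ∀ X ∈ Q.UpmTensor B s, Φ (c.eval X) = c.eval X := by
    intro X hX
    induction hX using Submodule.span_induction with
    | zero =>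
      ext p q
      simp [Φ, eval, Matrix.sum_apply]
    | add X Y _ _ h₁ h₂ =>
      have : c.eval (X + Y) = c.eval X + c.eval Y := rfl
      rw [this, hadd, h₁, h₂]
    | smul r X _ h =>
      have : c.eval (r • X) = r • c.eval X := rfl
      rw [this, hsmul, h]
    | mem X hX =>
      obtain ⟨u, hu, b, rfl⟩ := hX
      exact hΦ_tens u hu b
  have : ((Q.UpmSubalgebra B s).map (c.evalHom B) : Set (Matrix ι ι B)) = {X | Φ X = X} := by
    ext X
    constructor
    · rintro ⟨Y, hY, rfl⟩
      exact hΦ Y hY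
    · intro hX
      rw [← show Φ X = X from hX]
      exact hΦ_mem X
  rw [this]
  refine isClosed_eq ?_ continuous_id
  refine continuous_pi fun p => continuous_pi fun q => ?_
  simp only [Φ, Matrix.sum_apply, Matrix.map_apply]
  fun_prop

end MatrixCorep

/-! ### Formal power series in the time -/

section Formal

open PowerSeries

lemma coeff_mul_congr {A : Type*} [Ring A] {x x' y y' : PowerSeries A} {n : ℕ}
    (hx : ∀ m ≤ n, coeff m x = coeff m x') (hy : ∀ m ≤ n, coeff m y = coeff m y') :
    coeff n (x * y) = coeff n (x' * y') := by
  rw [coeff_mul, coeff_mul]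
  refine Finset.sum_congr rfl fun p hp => ?_
  have := Finset.HasAntidiagonal.mem_antidiagonal.1 hp
  rw [hx _ (by omega), hy _ (by omega)]

variable {A : Type*} [Ring A] [Algebra ℂ A]

lemma coeff_complex_smul (n : ℕ) (c : ℂ) (x : PowerSeries A) :
    coeff n (c • x) = c • coeff n x := rfl

lemma coeff_fderivT (n : ℕ) (x : PowerSeries A) :
    coeff n (fderivT x) = ((n : ℂ) + 1) • coeff (n + 1) x := by simp [fderivT]

lemma coeff_fexp (n : ℕ) (x : A) : coeff n (fexp x) = ((n.factorial : ℂ)⁻¹) • x ^ n := by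
  simp [fexp]

lemma fderivT_mul (x y : PowerSeries A) :
    fderivT (x * y) = fderivT x * y + x * fderivT y := by
  ext n
  have h : ((n : ℂ) + 1) • coeff (n + 1) (x * y) =
      ∑ p ∈ Finset.HasAntidiagonal.antidiagonal (n + 1), (p.1 : ℂ) • (coeff p.1 x * coeff p.2 y) +
      ∑ p ∈ Finset.HasAntidiagonal.antidiagonal (n + 1), (p.2 : ℂ) • (coeff p.1 x * coeff p.2 y) := by
    rw [coeff_mul, Finset.smul_sum, ← Finset.sum_add_distrib]
    refine Finset.sum_congr rfl fun p hp => ?_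
    rw [← add_smul, ← Nat.cast_add, Finset.HasAntidiagonal.mem_antidiagonal.1 hp, Nat.cast_succ]
  rw [coeff_fderivT, h, Finset.Nat.sum_antidiagonal_succ, Finset.Nat.sum_antidiagonal_succ',
    map_add, coeff_mul, coeff_mul]
  simp [coeff_fderivT]

lemma fderivT_C (a : A) : fderivT (C a) = 0 := by
  ext n
  simp [coeff_fderivT, coeff_succ_C]

lemma fderivT_fexp (a : A) : fderivT (fexp a) = C a * fexp a := by
  ext n
  rw [coeff_fderivT, coeff_C_mul, coeff_fexp, coeff_fexp, mul_smul_comm, ← pow_succ', smul_smul,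
    Nat.factorial_succ]
  congr 1
  have : ((n : ℂ) + 1) ≠ 0 := Nat.cast_add_one_ne_zero n
  have : ((n.factorial : ℂ)) ≠ 0 := Nat.cast_ne_zero.2 n.factorial_ne_zero
  push_cast
  field_simp

lemma commute_C_fexp {a b : A} (h : Commute a b) : Commute (C a) (fexp b) := by
  ext n
  rw [coeff_C_mul, coeff_mul_C, coeff_fexp]
  exact (h.pow_right n).smul_right _

/-- A formal differential equation `c dx/dt = Φ(x)`, `c ≠ 0`, in which the `n`-th coefficient of
`Φ(x)` depends on the first `n` coefficients of `x` only, has at most one solution with given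
initial value. -/
lemma formal_ode_unique {c : ℂ} (hc : c ≠ 0) (Φ : PowerSeries A → PowerSeries A)
    (hΦ : ∀ x y : PowerSeries A, ∀ n, (∀ m ≤ n, coeff m x = coeff m y) →
      coeff n (Φ x) = coeff n (Φ y)) {x y : PowerSeries A} (hx : c • fderivT x = Φ x)
    (hy : c • fderivT y = Φ y) (h0 : coeff 0 x = coeff 0 y) : x = y := by
  ext n
  induction n using Nat.strong_induction_on with
  | _ n ih =>
    cases n with
    | zero => exact h0
    | succ n =>
      have h := hΦ x y n fun m hm => ih m (Nat.lt_succ_of_le hm)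
      rw [← hx, ← hy, coeff_complex_smul, coeff_complex_smul, coeff_fderivT, coeff_fderivT,
        smul_smul, smul_smul] at h
      exact smul_right_injective _ (mul_ne_zero hc (Nat.cast_add_one_ne_zero n)) h

/-- Uniqueness for the linear equation `c dx/dt = a(t) x - x b(t)`. -/
lemma formal_linear_ode_unique {c : ℂ} (hc : c ≠ 0) (a b : PowerSeries A) {x y : PowerSeries A}
    (hx : c • fderivT x = a * x - x * b) (hy : c • fderivT y = a * y - y * b)
    (h0 : coeff 0 x = coeff 0 y) : x = y :=
  formal_ode_unique hc (fun x => a * x - x * b) (fun x y n h => by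
    rw [map_sub, map_sub, coeff_mul_congr (fun _ _ => rfl) h, coeff_mul_congr h fun _ _ => rfl])
    hx hy h0

lemma fexp_mul_fexp {a b : A} (h : Commute a b) : fexp a * fexp b = fexp (a + b) := by
  refine formal_linear_ode_unique one_ne_zero (C (a + b)) 0 ?_ ?_ ?_
  · rw [one_smul, fderivT_mul, fderivT_fexp, fderivT_fexp, mul_zero, sub_zero, map_add, add_mul,
      mul_assoc, ← mul_assoc (fexp a), (commute_C_fexp h.symm).eq.symm, mul_assoc]
  · rw [one_smul, fderivT_fexp, mul_zero, sub_zero]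
  · rw [coeff_mul]
    simp [coeff_fexp]

lemma fexp_mul_fexp_neg (a : A) : fexp a * fexp (-a) = 1 := by
  rw [fexp_mul_fexp (Commute.refl a).neg_right, add_neg_cancel]
  ext n
  cases n <;> simp [coeff_fexp, coeff_one]

lemma fexp_neg_mul_fexp (a : A) : fexp (-a) * fexp a = 1 := by
  simpa using fexp_mul_fexp_neg (-a)

/-- `exp(t a)` as an invertible power series. -/
noncomputable def fexpUnit (a : A) : (PowerSeries A)ˣ :=
  ⟨fexp a, fexp (-a), fexp_mul_fexp_neg a, fexp_neg_mul_fexp a⟩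

lemma val_inv_fexpUnit (a : A) : ((fexpUnit a)⁻¹ : (PowerSeries A)ˣ) = fexp (-a) := rfl

lemma coeff_mul_mem (S : Subalgebra ℂ A) {x y : PowerSeries A} (hx : ∀ n, coeff n x ∈ S)
    (hy : ∀ n, coeff n y ∈ S) (n : ℕ) : coeff n (x * y) ∈ S := by
  rw [coeff_mul]
  exact sum_mem fun p _ => mul_mem (hx _) (hy _)

lemma coeff_fexp_mem (S : Subalgebra ℂ A) {a : A} (ha : a ∈ S) (n : ℕ) :
    coeff n (fexp a) ∈ S := by
  rw [coeff_fexp]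
  exact S.smul_mem (pow_mem ha n) _

lemma I_smul_fderivT_fexp (a : A) :
    Complex.I • fderivT (fexp (-(Complex.I • a))) = C a * fexp (-(Complex.I • a)) := by
  rw [fderivT_fexp]
  ext n
  rw [coeff_complex_smul, coeff_C_mul, coeff_C_mul, ← smul_mul_assoc, smul_neg, smul_smul,
    Complex.I_mul_I, neg_one_smul, neg_neg]

lemma I_smul_fderivT_fexp' (a : A) :
    Complex.I • fderivT (fexp (Complex.I • a)) = -(C a * fexp (Complex.I • a)) := by
  have h := I_smul_fderivT_fexp (-a)
  rwa [smul_neg, neg_neg, map_neg, neg_mul] at h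

lemma complex_smul_mul (c : ℂ) (x y : PowerSeries A) : c • (x * y) = c • x * y :=
  (smul_mul_assoc c x y).symm

lemma complex_smul_mul' (c : ℂ) (x y : PowerSeries A) : c • (x * y) = x * c • y :=
  (mul_smul_comm c x y).symm

/-- The evolution `exp(-i t a) x exp(i t a)` generated by `a`, in formal time. -/
noncomputable def fconj (a x : A) : PowerSeries A :=
  fexp (-(Complex.I • a)) * C x * fexp (Complex.I • a)

lemma fconj_mul (a x y : A) : fconj a x * fconj a y = fconj a (x * y) := by
  have h := fexp_mul_fexp_neg (Complex.I • a)
  calc _ = fexp (-(Complex.I • a)) * C x * (fexp (Complex.I • a) * fexp (-(Complex.I • a))) *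
        C y * fexp (Complex.I • a) := by simp only [fconj, mul_assoc]
    _ = _ := by rw [h, mul_one, fconj, map_mul, mul_assoc _ (C x)]

lemma fconj_sub (a x y : A) : fconj a (x - y) = fconj a x - fconj a y := by
  simp only [fconj, map_sub, mul_sub, sub_mul]

lemma fconj_self (a : A) : fconj a a = C a := by
  have e : C a * fexp (Complex.I • a) = fexp (Complex.I • a) * C a :=
    commute_C_fexp ((Commute.refl a).smul_right _)
  rw [fconj, mul_assoc, e, ← mul_assoc, fexp_neg_mul_fexp, one_mul]

lemma coeff_zero_fconj (a x : A) : coeff 0 (fconj a x) = x := by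
  simp [fconj, coeff_mul, coeff_fexp]

lemma I_smul_fderivT_fconj (a x : A) :
    Complex.I • fderivT (fconj a x) = C a * fconj a x - fconj a x * C a := by
  have e : C a * fexp (Complex.I • a) = fexp (Complex.I • a) * C a :=
    commute_C_fexp ((Commute.refl a).smul_right _)
  rw [fconj, fderivT_mul, fderivT_mul, fderivT_C, mul_zero, add_zero, smul_add,
    complex_smul_mul, complex_smul_mul, I_smul_fderivT_fexp, complex_smul_mul',
    I_smul_fderivT_fexp', e, mul_neg, ← sub_eq_add_neg]
  simp only [mul_assoc]

lemma eq_fconj {a : A} {X : PowerSeries A}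
    (h : Complex.I • fderivT X = C a * X - X * C a) : X = fconj a (coeff 0 X) :=
  formal_linear_ode_unique Complex.I_ne_zero _ _ h (I_smul_fderivT_fconj a _)
    (coeff_zero_fconj a _).symm

end Formal

/-! ### The Lax equation in formal time -/

section FormalLax

open PowerSeries

variable {V F : Type*} [Fintype V] [DecidableEq V] [Ring F] [Algebra ℂ F] [Coalgebra ℂ F]

lemma isHeisenberg_iff (h : F) (T : PowerSeries (Conv ℂ F F)) :
    IsHeisenberg h T ↔
      Complex.I • fderivT T = C (oneTens h) * T - T * C (oneTens h) := by
  have e : (∀ f n, (coeff n (Complex.I • fderivT T)).ofConv f =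
      (coeff n (C (oneTens h) * T - T * C (oneTens h))).ofConv f) ↔ IsHeisenberg h T := by
    refine forall_congr' fun f => Iff.trans (forall_congr' fun n => ?_) PowerSeries.ext_iff.symm
    rw [map_sub, map_sub, coeff_C_mul, coeff_C_mul, coeff_mul_C, coeff_mul_C, ofConv_sub,
      LinearMap.sub_apply, oneTens_mul_apply, mul_oneTens_apply, coeff_complex_smul,
      coeff_complex_smul, coeff_fderivT, coeff_fderivT]
    simp [fapply]
  rw [← e]
  exact ⟨fun H => PowerSeries.ext fun n => Conv.ext fun f => H f n, fun H f n => by rw [H]⟩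

lemma coeff_fM (Q : CoquasitriangularFaceHopfAlgebra ℂ V F) (s : Sgn) (h : F)
    (T : PowerSeries (Conv ℂ F F)) (n : ℕ) : coeff n (fM Q s h T) = Q.M s h (coeff n T) := by
  simp [fM]

/-- `M^±(t)`, formed from the evolution of `X`, is the evolution of `M^±`: both solve
`i dN/dt = [1 ⊗ h, N]`, as `X ↦ 1 ⊗ X(h) - R^±(h₂) ⊗ X(h₁)` is linear over `1 ⊗ F`. -/
lemma fM_fconj (Q : CoquasitriangularFaceHopfAlgebra ℂ V F) (s : Sgn) (h : F) (X : Conv ℂ F F) :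
    fM Q s h (fconj (oneTens h) X) = fconj (oneTens h) (Q.M s h X) := by
  have H : Complex.I • fderivT (fM Q s h (fconj (oneTens h) X)) =
      C (oneTens h) * fM Q s h (fconj (oneTens h) X) -
        fM Q s h (fconj (oneTens h) X) * C (oneTens h) := by
    ext1 n
    have h1 := congr(Q.Mlin s h (coeff n $(I_smul_fderivT_fconj (oneTens h) X)))
    rw [map_sub, coeff_C_mul, coeff_mul_C, coeff_complex_smul, coeff_fderivT, map_smul, map_smul,
      map_sub, Q.Mlin_apply, Q.Mlin_apply, Q.Mlin_apply, Q.M_oneTens_mul, Q.M_mul_oneTens] at h1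
    rw [map_sub, coeff_C_mul, coeff_mul_C, coeff_complex_smul, coeff_fderivT, coeff_fM, coeff_fM,
      h1]
  rw [eq_fconj H, coeff_fM, coeff_zero_fconj]

namespace CoquasitriangularFaceHopfAlgebra

variable (Q : CoquasitriangularFaceHopfAlgebra ℂ V F)

/-- `[1 ⊗ h, T] = [M^±, T]`, since `m_±` commutes with `T`. -/
lemma M_univT_lie (s : Sgn) {h : F} (hh : IsCocommutative ℂ h) :
    oneTens h * univT ℂ F - univT ℂ F * oneTens h =
      Q.M s h (univT ℂ F) * univT ℂ F - univT ℂ F * Q.M s h (univT ℂ F) := by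
  rw [Q.M_univT, sub_mul, mul_sub, (Q.m_univT_commute s hh).eq]
  abel

/-- The commutator with `M^±(t)` of the Heisenberg evolution of `T` is that with `1 ⊗ h`. -/
lemma fM_lie_fconj (s : Sgn) {h : F} (hh : IsCocommutative ℂ h) :
    fM Q s h (fconj (oneTens h) (univT ℂ F)) * fconj (oneTens h) (univT ℂ F) -
        fconj (oneTens h) (univT ℂ F) * fM Q s h (fconj (oneTens h) (univT ℂ F)) =
      C (oneTens h) * fconj (oneTens h) (univT ℂ F) -
        fconj (oneTens h) (univT ℂ F) * C (oneTens h) := by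
  rw [fM_fconj, fconj_mul, fconj_mul, ← fconj_sub, ← Q.M_univT_lie s hh, fconj_sub, ← fconj_mul,
    ← fconj_mul, fconj_self]

lemma isHeisenberg_fconj (h : F) (X : Conv ℂ F F) : IsHeisenberg h (fconj (oneTens h) X) :=
  (isHeisenberg_iff h _).2 (I_smul_fderivT_fconj _ _)

lemma isLax_fconj (s : Sgn) {h : F} (hh : IsCocommutative ℂ h) :
    IsLax Q s h (fconj (oneTens h) (univT ℂ F)) :=
  (I_smul_fderivT_fconj _ _).trans (Q.fM_lie_fconj s hh).symm

/-- Both equations determine `T(t)` from `T(0) = T`, and the Heisenberg evolution solves both. The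
Lax equation is quadratic in `T(t)`, but its `n`-th coefficient still involves only the first `n`
coefficients of `T(t)`. -/
lemma isHeisenberg_iff_isLax (s : Sgn) {h : F} (hh : IsCocommutative ℂ h)
    {T : PowerSeries (Conv ℂ F F)} (h0 : coeff 0 T = univT ℂ F) :
    IsHeisenberg h T ↔ IsLax Q s h T := by
  constructor
  · intro H
    rw [eq_fconj ((isHeisenberg_iff h T).1 H), h0]
    exact Q.isLax_fconj s hh
  · intro H
    have : T = fconj (oneTens h) (univT ℂ F) := by
      refine formal_ode_unique Complex.I_ne_zero (fun T => fM Q s h T * T - T * fM Q s h T)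
        (fun x y n hxy => ?_) H (Q.isLax_fconj s hh) (by rw [h0, coeff_zero_fconj])
      have hM : ∀ m ≤ n, coeff m (fM Q s h x) = coeff m (fM Q s h y) := fun m hm => by
        rw [coeff_fM, coeff_fM, hxy m hm]
      rw [map_sub, map_sub, coeff_mul_congr hM hxy, coeff_mul_congr hxy hM]
    rw [this]
    exact isHeisenberg_fconj h _

/-- The factors `g_±(t) = exp(-i t (1 ⊗ h)) exp(i t m_±)`. -/
noncomputable def fgUnit (h : F) (s : Sgn) : (PowerSeries (Conv ℂ F F))ˣ :=
  fexpUnit (-(Complex.I • oneTens h)) * fexpUnit (Complex.I • Q.m s h (univT ℂ F))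

lemma val_fgUnit (h : F) (s : Sgn) : (Q.fgUnit h s : PowerSeries (Conv ℂ F F)) =
    fexp (-(Complex.I • oneTens h)) * fexp (Complex.I • Q.m s h (univT ℂ F)) := rfl

lemma val_inv_fgUnit (h : F) (s : Sgn) :
    ((Q.fgUnit h s)⁻¹ : (PowerSeries (Conv ℂ F F))ˣ) =
      fexp (-(Complex.I • Q.m s h (univT ℂ F))) * fexp (Complex.I • (oneTens h : Conv ℂ F F)) := by
  rw [fgUnit, mul_inv_rev, Units.val_mul, val_inv_fexpUnit, val_inv_fexpUnit, neg_neg]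

/-- The factorization `g_-⁻¹ g_+ = exp(i t (m_+ - m_-))`, from `[m_+, m_-] = 0`. -/
lemma fgUnit_inv_mul {h : F} (hh : IsCocommutative ℂ h) :
    (((Q.fgUnit h .minus)⁻¹ * Q.fgUnit h .plus : (PowerSeries (Conv ℂ F F))ˣ) :
        PowerSeries (Conv ℂ F F)) =
      fexp (Complex.I • (Q.m .plus h (univT ℂ F) - Q.m .minus h (univT ℂ F))) := by
  have hc := (Q.m_plus_m_minus_commute hh)
  have hc' : Commute (-(Complex.I • Q.m .minus h (univT ℂ F)))
      (Complex.I • Q.m .plus h (univT ℂ F)) :=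
    ((hc.symm.smul_left _).smul_right _).neg_left
  rw [Units.val_mul, val_inv_fgUnit, val_fgUnit, mul_assoc, ← mul_assoc (fexp (_ • oneTens h)),
    fexp_mul_fexp_neg, one_mul, fexp_mul_fexp hc', smul_sub, neg_add_eq_sub]

/-- Both `g_±` conjugate `T` into its Heisenberg evolution, since `m_±` commutes with `T`. -/
lemma fgUnit_conj (s : Sgn) {h : F} (hh : IsCocommutative ℂ h) :
    fconj (oneTens h) (univT ℂ F) =
      Q.fgUnit h s * C (univT ℂ F) * ((Q.fgUnit h s)⁻¹ : (PowerSeries (Conv ℂ F F))ˣ) := by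
  have hc : C (univT ℂ F) * fexp (-(Complex.I • Q.m s h (univT ℂ F))) =
      fexp (-(Complex.I • Q.m s h (univT ℂ F))) * C (univT ℂ F) :=
    commute_C_fexp ((Q.m_univT_commute s hh).symm.smul_right _).neg_right
  calc _ = fexp (-(Complex.I • oneTens h)) * (fexp (Complex.I • Q.m s h (univT ℂ F)) *
        fexp (-(Complex.I • Q.m s h (univT ℂ F)))) * C (univT ℂ F) *
          fexp (Complex.I • oneTens h) := by rw [fexp_mul_fexp_neg, mul_one, fconj]
    _ = _ := by
      rw [val_inv_fgUnit, val_fgUnit]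
      simp only [mul_assoc]
      rw [← mul_assoc (C _), hc, mul_assoc]

lemma coeff_fgUnit_mem (h : F) (s : Sgn) (n : ℕ) :
    coeff n (Q.fgUnit h s : PowerSeries (Conv ℂ F F)) ∈ Q.UpmTensor F s := by
  have h1 := Q.oneTens_mem_UpmSubalgebra s h
  have h2 := Q.m_mem_UpmSubalgebra s h (univT ℂ F)
  exact coeff_mul_mem (Q.UpmSubalgebra F s)
    (coeff_fexp_mem _ (neg_mem (Subalgebra.smul_mem _ h1 _)))
    (coeff_fexp_mem _ (Subalgebra.smul_mem _ h2 _)) n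

/-- `g_±` is the solution of `i dg/dt = M^±(t) g`, `g(0) = 1`. -/
lemma fgUnit_ode_iff (s : Sgn) (h : F) (x : PowerSeries (Conv ℂ F F)) :
    (Complex.I • fderivT x = fM Q s h (fconj (oneTens h) (univT ℂ F)) * x ∧ coeff 0 x = 1) ↔
      x = Q.fgUnit h s := by
  have hg : Complex.I • fderivT (Q.fgUnit h s : PowerSeries (Conv ℂ F F)) =
      fM Q s h (fconj (oneTens h) (univT ℂ F)) * (Q.fgUnit h s : PowerSeries (Conv ℂ F F)) := by
    have e : C (oneTens h) * fexp (-(Complex.I • (oneTens h : Conv ℂ F F))) =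
        fexp (-(Complex.I • oneTens h)) * C (oneTens h : Conv ℂ F F) :=
      commute_C_fexp (((Commute.refl (oneTens h : Conv ℂ F F)).smul_right Complex.I).neg_right)
    have e2 := fexp_mul_fexp_neg (Complex.I • (oneTens h : Conv ℂ F F))
    rw [fM_fconj, val_fgUnit, fderivT_mul, smul_add, complex_smul_mul, complex_smul_mul',
      I_smul_fderivT_fexp, I_smul_fderivT_fexp', fconj, mul_assoc _ (fexp (Complex.I • oneTens h)),
      ← mul_assoc (fexp (Complex.I • oneTens h)), e2, one_mul, Q.M_univT, e, map_sub]
    noncomm_ring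
  have h0 : coeff 0 (Q.fgUnit h s : PowerSeries (Conv ℂ F F)) = 1 := by
    rw [val_fgUnit, coeff_mul]
    simp [coeff_fexp]
  constructor
  · rintro ⟨hx, hx0⟩
    exact formal_linear_ode_unique Complex.I_ne_zero
      (fM Q s h (fconj (oneTens h) (univT ℂ F))) 0 (by rw [hx, mul_zero, sub_zero])
      (by rw [hg, mul_zero, sub_zero]) (by rw [hx0, h0])
  · rintro rfl
    exact ⟨hg, h0⟩

lemma fvertex_eq (a b : V) (X : PowerSeries (Conv ℂ F F)) :
    fvertex Q a b X = C (tens (Q.ELo a) 1) * X * C (tens (Q.ELo b) 1) := by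
  ext1 n
  rw [coeff_mul_C, coeff_C_mul, fvertex, coeff_mk]
  rfl

lemma fvertex_C_univT (a b : V) :
    fvertex Q a b (C (univT ℂ F)) = C (Q.vertexT a b) := by
  rw [fvertex_eq, ← map_mul, ← map_mul, ← Q.vertex_univT, FaceAlgebra.vertex]

lemma sum_fvertex_mul_fvertex (a b : V) (X Y : PowerSeries (Conv ℂ F F)) :
    ∑ c, fvertex Q a c X * fvertex Q c b Y = fvertex Q a b (X * Y) := by
  have h := congr(C $(Q.sum_ELo_mul_ELo F))
  simp only [map_sum, map_mul, map_one] at h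
  calc _ = ∑ c, C (tens (Q.ELo a) 1) * X * (C (tens (Q.ELo c) 1) * C (tens (Q.ELo c) 1)) *
        (Y * C (tens (Q.ELo b) 1)) :=
        Finset.sum_congr rfl fun d _ => by simp only [fvertex_eq, mul_assoc]
    _ = _ := by
      rw [← Finset.sum_mul, ← Finset.mul_sum, h, mul_one, fvertex_eq]
      simp only [mul_assoc]

/-- The dynamical Lax equation: multiply the Lax equation by `E_a` and `E_b`, and insert
`∑_c E_c E_c = 1`. -/
lemma fvertex_lax {s : Sgn} {h : F} {T : PowerSeries (Conv ℂ F F)} (hT : IsLax Q s h T)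
    (a b : V) :
    Complex.I • fderivT (fvertex Q a b T) =
      ∑ c, (fvertex Q a c (fM Q s h T) * fvertex Q c b T -
        fvertex Q a c T * fvertex Q c b (fM Q s h T)) := by
  rw [Finset.sum_sub_distrib, sum_fvertex_mul_fvertex, sum_fvertex_mul_fvertex, fvertex_eq,
    fderivT_mul, fderivT_mul, fderivT_C, fderivT_C, zero_mul, mul_zero, zero_add, add_zero,
    complex_smul_mul, complex_smul_mul', hT, fvertex_eq, fvertex_eq, mul_sub, sub_mul]

end CoquasitriangularFaceHopfAlgebra

end FormalLax

/-! ### The Lax equation in a Banach algebra -/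

section Banach

open NormedSpace

section Algebraic

variable {A : Type*} [NormedRing A] [NormedAlgebra ℂ A]

lemma commute_exp_I_smul (a : A) (t : ℝ) : Commute a (exp ((Complex.I * (t : ℂ)) • a)) :=
  ((Commute.refl a).smul_right _).exp_right

lemma commute_exp_neg_I_smul (a : A) (t : ℝ) :
    Commute a (exp (-((Complex.I * (t : ℂ)) • a))) :=
  ((Commute.refl a).smul_right _).neg_right.exp_right

lemma evolve_eq (a : A) (t : ℝ) (x : A) : evolve a t x =
    exp (-((Complex.I * (t : ℂ)) • a)) * x * exp ((Complex.I * (t : ℂ)) • a) := by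
  rw [evolve, neg_smul]

lemma evolve_sub (a : A) (t : ℝ) (x y : A) :
    evolve a t (x - y) = evolve a t x - evolve a t y := by
  simp only [evolve, mul_sub, sub_mul]

lemma evolve_zero (a x : A) : evolve a 0 x = x := by simp [evolve]

lemma exp_mem_subalgebra (S : Subalgebra ℂ A) (hS : IsClosed (S : Set A)) {a : A} (ha : a ∈ S) :
    exp a ∈ S := by
  let _ : NormedAlgebra ℚ A := NormedAlgebra.restrictScalars ℚ ℂ A
  have : IsScalarTower ℚ ℂ A := IsScalarTower.of_algebraMap_smul fun _ _ => rfl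
  exact exp_mem (R := ℂ) hS ha

end Algebraic

variable {A : Type*} [NormedRing A] [NormedAlgebra ℂ A] [CompleteSpace A]

lemma exp_mul_exp_neg (a : A) : exp a * exp (-a) = 1 := by
  let _ : NormedAlgebra ℚ A := NormedAlgebra.restrictScalars ℚ ℂ A
  rw [← exp_add_of_commute (Commute.refl a).neg_right, add_neg_cancel, exp_zero]

lemma exp_neg_mul_exp (a : A) : exp (-a) * exp a = 1 := by
  simpa using exp_mul_exp_neg (-a)

/-- `exp(a)` as an invertible element. -/
noncomputable def expUnit (a : A) : Aˣ :=
  ⟨exp a, exp (-a), exp_mul_exp_neg a, exp_neg_mul_exp a⟩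

lemma hasDerivAt_exp_I_smul (a : A) (t : ℝ) :
    HasDerivAt (fun t : ℝ => exp ((Complex.I * (t : ℂ)) • a))
      (Complex.I • (a * exp ((Complex.I * (t : ℂ)) • a))) t := by
  have e : ∀ r : ℝ, (Complex.I * (r : ℂ)) • a = r • (Complex.I • a) := fun r => by
    rw [mul_comm, mul_smul, Complex.coe_smul]
  simp only [e]
  rw [← smul_mul_assoc]
  exact hasDerivAt_exp_smul_const' (𝕂 := ℝ) (Complex.I • a) t

lemma hasDerivAt_exp_neg_I_smul (a : A) (t : ℝ) :
    HasDerivAt (fun t : ℝ => exp (-((Complex.I * (t : ℂ)) • a)))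
      (-(Complex.I • (a * exp (-((Complex.I * (t : ℂ)) • a))))) t := by
  have h := hasDerivAt_exp_I_smul (-a) t
  simpa only [smul_neg, neg_mul] using h

/-- The solution of the linear equation `dx/dt = i (a x - x b)`. -/
lemma eq_exp_mul_mul_exp {a b : A} {x : ℝ → A}
    (hx : ∀ t, HasDerivAt x (Complex.I • (a * x t - x t * b)) t) (t : ℝ) :
    x t = exp ((Complex.I * (t : ℂ)) • a) * x 0 * exp (-((Complex.I * (t : ℂ)) • b)) := by
  -- `exp(-i t a) x(t) exp(i t b)` is constant
  have hd : ∀ t : ℝ, HasDerivAt (fun t : ℝ => exp (-((Complex.I * (t : ℂ)) • a)) * x t *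
      exp ((Complex.I * (t : ℂ)) • b)) 0 t := fun t => by
    refine (((hasDerivAt_exp_neg_I_smul a t).mul (hx t)).mul
      (hasDerivAt_exp_I_smul b t)).congr_deriv ?_
    rw [(commute_exp_neg_I_smul a t).eq]
    simp only [Pi.mul_apply, smul_mul_assoc, mul_smul_comm, neg_mul, smul_sub, mul_sub, sub_mul,
      add_mul, mul_assoc]
    abel
  have hc := is_const_of_deriv_eq_zero (fun t => (hd t).differentiableAt)
    (fun t => (hd t).deriv) t 0
  simp only [Complex.ofReal_zero, mul_zero, zero_smul, neg_zero, exp_zero, one_mul, mul_one] at hc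
  rw [← hc, mul_assoc, mul_assoc, exp_mul_exp_neg, mul_one, ← mul_assoc, exp_mul_exp_neg, one_mul]

lemma evolve_mul (a : A) (t : ℝ) (x y : A) :
    evolve a t x * evolve a t y = evolve a t (x * y) := by
  have h := exp_mul_exp_neg ((Complex.I * (t : ℂ)) • a)
  simp only [evolve_eq]
  calc _ = exp (-((Complex.I * (t : ℂ)) • a)) * x *
        (exp ((Complex.I * (t : ℂ)) • a) * exp (-((Complex.I * (t : ℂ)) • a))) * y *
          exp ((Complex.I * (t : ℂ)) • a) := by simp only [mul_assoc]
    _ = _ := by rw [h, mul_one, mul_assoc _ x]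

lemma evolve_self (a : A) (t : ℝ) : evolve a t a = a := by
  rw [evolve_eq, mul_assoc, (commute_exp_I_smul a t).eq, ← mul_assoc, exp_neg_mul_exp, one_mul]

lemma exp_mul_evolve (a : A) (t : ℝ) (x : A) :
    exp ((Complex.I * (t : ℂ)) • a) * evolve a t x = x * exp ((Complex.I * (t : ℂ)) • a) := by
  rw [evolve_eq, ← mul_assoc, ← mul_assoc, exp_mul_exp_neg, one_mul]

lemma evolve_mul_exp_neg (a : A) (t : ℝ) (x : A) :
    evolve a t x * exp (-((Complex.I * (t : ℂ)) • a)) =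
      exp (-((Complex.I * (t : ℂ)) • a)) * x := by
  rw [evolve_eq, mul_assoc, exp_mul_exp_neg, mul_one]

lemma hasDerivAt_evolve (a x : A) (t : ℝ) :
    HasDerivAt (fun t => evolve a t x)
      (-Complex.I • (a * evolve a t x - evolve a t x * a)) t := by
  simp only [evolve_eq]
  refine (((hasDerivAt_exp_neg_I_smul a t).mul_const x).mul
    (hasDerivAt_exp_I_smul a t)).congr_deriv ?_
  rw [(commute_exp_I_smul a t).eq]
  simp only [smul_mul_assoc, mul_smul_comm, neg_mul, neg_smul, ← smul_neg, ← smul_add]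
  congr 1
  noncomm_ring

lemma eq_evolve_of_heisenberg {a : A} {L : ℝ → A}
    (hL : ∀ t, HasDerivAt L (-Complex.I • (a * L t - L t * a)) t) (t : ℝ) :
    L t = evolve a t (L 0) := by
  have h := eq_exp_mul_mul_exp (a := -a) (b := -a) (x := L) (fun t => (hL t).congr_deriv (by
    rw [neg_smul, ← smul_neg]; congr 1; noncomm_ring)) t
  rw [h, evolve_eq, smul_neg, neg_neg]

variable {H T₀ m : A}

/-- Commutators with `M(t)` and with `H` agree on the evolution of `T₀` if `m = H - M` commutes
with `T₀`. -/
lemma evolve_lie (hT : Commute m T₀) (t : ℝ) :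
    evolve H t (H - m) * evolve H t T₀ - evolve H t T₀ * evolve H t (H - m) =
      H * evolve H t T₀ - evolve H t T₀ * H := by
  conv_rhs => rw [← evolve_self H t, evolve_self H t]
  have e : (H - m) * T₀ - T₀ * (H - m) = H * T₀ - T₀ * H := by
    rw [sub_mul, mul_sub, hT.eq]; abel
  rw [evolve_mul, evolve_mul, ← evolve_sub, e, evolve_sub, ← evolve_mul, ← evolve_mul, evolve_self]

/-- In the interaction picture `K = exp(i t H) L exp(-i t H)` the Lax equation becomes
`dK/dt = i [m, K]`, whose solution with `K(0) = T₀` is constant. -/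
lemma eq_evolve_of_lax (hT : Commute m T₀) {L : ℝ → A} (h0 : L 0 = T₀)
    (hL : ∀ t, HasDerivAt L
      (-Complex.I • (evolve H t (H - m) * L t - L t * evolve H t (H - m))) t) (t : ℝ) :
    L t = evolve H t T₀ := by
  have hd : ∀ t : ℝ, HasDerivAt (fun t : ℝ => exp ((Complex.I * (t : ℂ)) • H) * L t *
      exp (-((Complex.I * (t : ℂ)) • H)))
      (Complex.I • (m * (exp ((Complex.I * (t : ℂ)) • H) * L t *
        exp (-((Complex.I * (t : ℂ)) • H))) - exp ((Complex.I * (t : ℂ)) • H) * L t *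
          exp (-((Complex.I * (t : ℂ)) • H)) * m)) t := fun t => by
    refine (((hasDerivAt_exp_I_smul H t).mul (hL t)).mul
      (hasDerivAt_exp_neg_I_smul H t)).congr_deriv ?_
    have e1 := exp_mul_evolve H t (H - m)
    have e2 := evolve_mul_exp_neg H t (H - m)
    have e3 : exp ((Complex.I * (t : ℂ)) • H) *
        (evolve H t (H - m) * L t - L t * evolve H t (H - m)) *
          exp (-((Complex.I * (t : ℂ)) • H)) =
        (H - m) * exp ((Complex.I * (t : ℂ)) • H) * L t * exp (-((Complex.I * (t : ℂ)) • H)) -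
          exp ((Complex.I * (t : ℂ)) • H) * L t * exp (-((Complex.I * (t : ℂ)) • H)) *
            (H - m) := by
      rw [mul_sub, sub_mul, ← mul_assoc, e1]
      simp only [mul_assoc, e2]
    rw [add_mul, mul_smul_comm, smul_mul_assoc (-Complex.I), e3,
      (commute_exp_neg_I_smul H t).eq]
    simp only [Pi.mul_apply, smul_mul_assoc, mul_smul_comm, mul_neg, smul_sub, mul_sub,
      sub_mul, mul_assoc, neg_smul]
    abel
  have h := eq_exp_mul_mul_exp hd t
  simp only [Complex.ofReal_zero, mul_zero, zero_smul, neg_zero, exp_zero, one_mul, mul_one,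
    h0] at h
  rw [(hT.symm.smul_right _).exp_right.symm.eq, mul_assoc T₀, exp_mul_exp_neg, mul_one] at h
  rw [evolve_eq, ← h, mul_assoc, mul_assoc, exp_neg_mul_exp, mul_one, ← mul_assoc,
    exp_neg_mul_exp, one_mul]

/-- Either equation forces `L(t)` to be the evolution of `T₀`, along which the two right-hand sides
agree. -/
lemma heisenberg_iff_lax (hT : Commute m T₀) {L : ℝ → A} (h0 : L 0 = T₀) :
    (∀ t, HasDerivAt L (-Complex.I • (H * L t - L t * H)) t) ↔
      ∀ t, HasDerivAt L
        (-Complex.I • (evolve H t (H - m) * L t - L t * evolve H t (H - m))) t := by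
  constructor
  · intro hL t
    have h := hL t
    rw [eq_evolve_of_heisenberg hL, h0] at h
    rwa [eq_evolve_of_heisenberg hL, h0, evolve_lie hT]
  · intro hL t
    have h := hL t
    rw [eq_evolve_of_lax hT h0 hL, evolve_lie hT] at h
    rwa [eq_evolve_of_lax hT h0 hL]

variable (H m) in
/-- The factor `g(t) = exp(-i t H) exp(i t m)`. -/
noncomputable def gUnit (t : ℝ) : Aˣ :=
  expUnit (-((Complex.I * (t : ℂ)) • H)) * expUnit ((Complex.I * (t : ℂ)) • m)

lemma val_gUnit (t : ℝ) : (gUnit H m t : A) =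
    exp (-((Complex.I * (t : ℂ)) • H)) * exp ((Complex.I * (t : ℂ)) • m) := rfl

lemma val_inv_gUnit (t : ℝ) : ((gUnit H m t)⁻¹ : Aˣ) =
    exp (-((Complex.I * (t : ℂ)) • m)) * exp ((Complex.I * (t : ℂ)) • H) := by
  rw [gUnit, mul_inv_rev, Units.val_mul]
  change exp _ * exp (- -_) = _
  rw [neg_neg]

lemma gUnit_inv_mul {m' : A} (hm : Commute m m') (t : ℝ) :
    (((gUnit H m' t)⁻¹ * gUnit H m t : Aˣ) : A) = exp ((Complex.I * (t : ℂ)) • (m - m')) := by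
  let _ : NormedAlgebra ℚ A := NormedAlgebra.restrictScalars ℚ ℂ A
  have hc : Commute (-((Complex.I * (t : ℂ)) • m')) ((Complex.I * (t : ℂ)) • m) :=
    ((hm.symm.smul_left _).smul_right _).neg_left
  rw [Units.val_mul, val_inv_gUnit, val_gUnit, mul_assoc, ← mul_assoc (exp (_ • H)),
    exp_mul_exp_neg, one_mul, ← exp_add_of_commute hc, smul_sub, neg_add_eq_sub]

lemma gUnit_conj (hT : Commute m T₀) (t : ℝ) :
    evolve H t T₀ = gUnit H m t * T₀ * ((gUnit H m t)⁻¹ : Aˣ) := by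
  have hc : T₀ * exp (-((Complex.I * (t : ℂ)) • m)) = exp (-((Complex.I * (t : ℂ)) • m)) * T₀ :=
    (hT.symm.smul_right _).neg_right.exp_right
  calc _ = exp (-((Complex.I * (t : ℂ)) • H)) * (exp ((Complex.I * (t : ℂ)) • m) *
        exp (-((Complex.I * (t : ℂ)) • m))) * T₀ * exp ((Complex.I * (t : ℂ)) • H) := by
        rw [exp_mul_exp_neg, mul_one, evolve_eq]
    _ = _ := by
      rw [val_inv_gUnit, val_gUnit]
      simp only [mul_assoc]
      rw [← mul_assoc T₀, hc, mul_assoc]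

lemma hasDerivAt_gUnit (t : ℝ) :
    HasDerivAt (fun t => (gUnit H m t : A))
      (-Complex.I • (evolve H t (H - m) * gUnit H m t)) t := by
  simp only [val_gUnit]
  refine ((hasDerivAt_exp_neg_I_smul H t).mul (hasDerivAt_exp_I_smul m t)).congr_deriv ?_
  rw [← mul_assoc (evolve H t (H - m)), evolve_mul_exp_neg, (commute_exp_neg_I_smul H t).eq]
  simp only [smul_mul_assoc, mul_smul_comm, neg_mul, smul_sub, mul_sub, sub_mul, mul_assoc,
    neg_smul]
  abel

/-- `g` is the unique solution of `i dg/dt = M(t) g`, `g(0) = 1`: for a solution `x`, the product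
`exp(i t H) x` solves `dy/dt = i m y`. -/
lemma gUnit_ode_iff (x : ℝ → A) :
    ((∀ t, HasDerivAt x (-Complex.I • (evolve H t (H - m) * x t)) t) ∧ x 0 = 1) ↔
      ∀ t, x t = gUnit H m t := by
  constructor
  · rintro ⟨hx, h0⟩ t
    have hd : ∀ t : ℝ, HasDerivAt (fun t : ℝ => exp ((Complex.I * (t : ℂ)) • H) * x t)
        (Complex.I • (m * (exp ((Complex.I * (t : ℂ)) • H) * x t) -
          exp ((Complex.I * (t : ℂ)) • H) * x t * 0)) t := fun t => by
      refine ((hasDerivAt_exp_I_smul H t).mul (hx t)).congr_deriv ?_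
      rw [mul_smul_comm, ← mul_assoc, exp_mul_evolve]
      simp only [smul_mul_assoc, smul_sub, sub_mul, mul_assoc, neg_smul, mul_zero, smul_zero]
      abel
    have h := eq_exp_mul_mul_exp hd t
    simp only [Complex.ofReal_zero, mul_zero, zero_smul, smul_zero, neg_zero, exp_zero,
      mul_one, h0] at h
    rw [val_gUnit, ← h, ← mul_assoc, exp_neg_mul_exp, one_mul]
  · intro hx
    obtain rfl : x = fun t => (gUnit H m t : A) := funext hx
    exact ⟨hasDerivAt_gUnit, by simp [val_gUnit]⟩

lemma gUnit_mem (S : Subalgebra ℂ A) (hS : IsClosed (S : Set A)) (hH : H ∈ S) (hm : m ∈ S)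
    (t : ℝ) : (gUnit H m t : A) ∈ S :=
  mul_mem (exp_mem_subalgebra S hS (neg_mem (S.smul_mem hH _)))
    (exp_mem_subalgebra S hS (S.smul_mem hm _))

end Banach

/-! ### Real time in matrices over a Banach algebra -/

section Matrices

variable {V F B ι : Type*} [Fintype V] [DecidableEq V] [Ring F] [Algebra ℂ F]
  [Coalgebra ℂ F] [NormedRing B] [NormedAlgebra ℂ B] [Fintype ι] [DecidableEq ι]

/-- The normed ring of matrices with the `ℓ^∞`-operator norm. Its uniform structure is replaced by
that of entrywise convergence, so that derivatives and exponentials refer to the standard topology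
of matrices. -/
noncomputable abbrev matrixNormedRing {B ι : Type*} [NormedRing B] [Fintype ι] [DecidableEq ι] :
    NormedRing (Matrix ι ι B) :=
  let N : NormedRing (Matrix ι ι B) := Matrix.linftyOpNormedRing
  { (inferInstance : Ring (Matrix ι ι B)),
    N.toMetricSpace.replaceUniformity (U := Matrix.instUniformSpace ι ι B) rfl with
    norm := N.norm
    dist_eq := N.dist_eq
    norm_mul_le := N.norm_mul_le }

attribute [local instance] matrixNormedRing

/-- The normed algebra of matrices with the `ℓ^∞`-operator norm. -/
noncomputable abbrev matrixNormedAlgebra {B ι : Type*} [NormedRing B] [NormedAlgebra ℂ B]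
    [Fintype ι] [DecidableEq ι] : NormedAlgebra ℂ (Matrix ι ι B) :=
  { (inferInstance : Algebra ℂ (Matrix ι ι B)) with
    norm_smul_le := (Matrix.linftyOpNormedAlgebra (R := ℂ) (α := B) (n := ι)).norm_smul_le }

attribute [local instance] matrixNormedAlgebra

lemma hasDerivAt_vertex (Q : FaceAlgebra ℂ V F) (c : MatrixCorep ℂ F ι) (a b : V)
    {L : ℝ → Matrix ι ι B} {L' : Matrix ι ι B} {t : ℝ} (hL : HasDerivAt L L' t) :
    HasDerivAt (fun r => c.vertex Q a b (L r)) (c.vertex Q a b L') t :=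
  (hL.const_mul _).mul_const _

variable [CompleteSpace B]

lemma scalar_exp (b : B) : Matrix.scalar ι (NormedSpace.exp b) =
    NormedSpace.exp (Matrix.scalar ι b) := by
  let _ : NormedAlgebra ℚ B := NormedAlgebra.restrictScalars ℚ ℂ B
  let _ : NormedAlgebra ℚ (Matrix ι ι B) := NormedAlgebra.restrictScalars ℚ ℂ (Matrix ι ι B)
  exact NormedSpace.map_exp (Matrix.scalar ι)
    (Continuous.matrix_diagonal (continuous_pi fun _ => continuous_id)) b

lemma map_evolve (b : B) (t : ℝ) (X : Matrix ι ι B) :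
    X.map (evolve b t) = evolve (Matrix.scalar ι b) t X := by
  have e (z : ℂ) : NormedSpace.exp (z • Matrix.scalar ι b) =
      Matrix.scalar ι (NormedSpace.exp (z • b)) := by
    rw [scalar_exp]
    congr 1
    ext i j
    simp [Matrix.diagonal_apply, apply_ite (z • ·)]
  rw [evolve, e, e]
  ext i j
  simp [evolve, Matrix.scalar_apply]

lemma evolveM_eq (Q : CoquasitriangularFaceHopfAlgebra ℂ V F) (π : F →ₐ[ℂ] B)
    (c : MatrixCorep ℂ F ι) (s : Sgn) (h : F) (t : ℝ) :
    evolveM Q π c s h t =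
      evolve (Matrix.scalar ι (π h)) t (Matrix.scalar ι (π h) - c.eval (Q.m s h (repT π))) := by
  rw [evolveM, map_evolve, c.eval_M_repT]

/-- The real-time statements, obtained by applying the Banach algebra results to matrices over `B`,
with Hamiltonian `π(h) 1` and `m_±` evaluated in the corepresentation. -/
theorem matrix_lax (Q : CoquasitriangularFaceHopfAlgebra ℂ V F) {h : F}
    (hh : IsCocommutative ℂ h) (π : F →ₐ[ℂ] B) (c : MatrixCorep ℂ F ι) :
    (∀ (L : ℝ → Matrix ι ι B), L 0 = c.eval (repT π) → ∀ s,
          ((∀ t, HasDerivAt L (-Complex.I •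
              (Matrix.scalar ι (π h) * L t - L t * Matrix.scalar ι (π h))) t) ↔
            (∀ t, HasDerivAt L (-Complex.I • (evolveM Q π c s h t * L t -
              L t * evolveM Q π c s h t)) t))) ∧
        ∃ g : Sgn → ℝ → (Matrix ι ι B)ˣ, ∃ L : ℝ → Matrix ι ι B,
          (∀ s t, ∃ X ∈ Q.UpmTensor B s, c.eval X = g s t) ∧
          (∀ t, (((g .minus t)⁻¹ * g .plus t : (Matrix ι ι B)ˣ) : Matrix ι ι B) =
            NormedSpace.exp ((Complex.I * (t : ℂ)) •
              (c.eval (Q.m .plus h (repT π)) - c.eval (Q.m .minus h (repT π))))) ∧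
          (∀ s t, (g s t : Matrix ι ι B) =
            NormedSpace.exp (-((Complex.I * (t : ℂ)) • Matrix.scalar ι (π h))) *
              NormedSpace.exp ((Complex.I * (t : ℂ)) •
                (Matrix.scalar ι (π h) - c.eval (Q.M s h (repT π))))) ∧
          (∀ s t, L t = g s t * c.eval (repT π) * ((g s t)⁻¹ : (Matrix ι ι B)ˣ)) ∧
          L 0 = c.eval (repT π) ∧
          (∀ t, HasDerivAt L (-Complex.I •
            (Matrix.scalar ι (π h) * L t - L t * Matrix.scalar ι (π h))) t) ∧
          (∀ s t, HasDerivAt L (-Complex.I •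
            (evolveM Q π c s h t * L t - L t * evolveM Q π c s h t)) t) ∧
          (∀ s, ∀ x : ℝ → Matrix ι ι B,
            ((∀ t, HasDerivAt x (-Complex.I • (evolveM Q π c s h t * x t)) t) ∧ x 0 = 1) ↔
              ∀ t, x t = g s t) ∧
          (∀ s a b t, HasDerivAt (fun r => c.vertex Q.toFaceAlgebra a b (L r))
            (-Complex.I • ∑ d,
              (c.vertex Q.toFaceAlgebra a d (evolveM Q π c s h t) *
                  c.vertex Q.toFaceAlgebra d b (L t) -
                c.vertex Q.toFaceAlgebra a d (L t) *
                  c.vertex Q.toFaceAlgebra d b (evolveM Q π c s h t))) t) := by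
  have hT (s : Sgn) : Commute (c.eval (Q.m s h (repT π))) (c.eval (repT π)) :=
    (Q.m_repT_commute π s hh).map (c.evalHom B)
  have hm : Commute (c.eval (Q.m .plus h (repT π))) (c.eval (Q.m .minus h (repT π))) :=
    (Q.m_plus_m_minus_repT_commute π hh).map (c.evalHom B)
  set H : Matrix ι ι B := Matrix.scalar ι (π h)
  have hLax (s : Sgn) (t : ℝ) : HasDerivAt (fun t => evolve H t (c.eval (repT π)))
      (-Complex.I • (evolveM Q π c s h t * evolve H t (c.eval (repT π)) -
        evolve H t (c.eval (repT π)) * evolveM Q π c s h t)) t := by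
    rw [evolveM_eq, evolve_lie (hT s)]
    exact hasDerivAt_evolve H _ t
  refine ⟨fun L h0 s => ?_, fun s t => gUnit H (c.eval (Q.m s h (repT π))) t,
    fun t => evolve H t (c.eval (repT π)), fun s t => ?_, fun t => gUnit_inv_mul hm t,
    fun s t => ?_, fun s t => gUnit_conj (hT s) t, evolve_zero _ _,
    fun t => hasDerivAt_evolve H _ t, hLax, fun s x => ?_, fun s a b t => ?_⟩
  · simp only [evolveM_eq]
    exact heisenberg_iff_lax (hT s) h0
  · exact gUnit_mem ((Q.UpmSubalgebra B s).map (c.evalHom B)) (c.isClosed_map_UpmSubalgebra Q s)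
      ⟨oneTens (π h), Q.oneTens_mem_UpmSubalgebra s _, c.eval_oneTens _⟩
      ⟨_, Q.m_mem_UpmSubalgebra s h _, rfl⟩ t
  · rw [c.eval_M_repT, sub_sub_cancel, val_gUnit]
  · simp only [evolveM_eq]
    exact gUnit_ode_iff x
  · rw [c.vertex_lie]
    refine (hasDerivAt_vertex Q.toFaceAlgebra c a b (hLax s t)).congr_deriv ?_
    simp only [MatrixCorep.vertex, mul_smul_comm, smul_mul_assoc]

end Matrices

end FaceLax

open FaceLax
theorem mainTheorem10 {V F : Type*} [Fintype V] [DecidableEq V] [Ring F] [Algebra ℂ F]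
    [Coalgebra ℂ F] (Q : CoquasitriangularFaceHopfAlgebra ℂ V F) :
    -- (i) the cocommutative elements form a commutative subalgebra
    (∃ I : NonUnitalSubalgebra ℂ F, (∀ f, f ∈ I ↔ IsCocommutative ℂ f) ∧
      ∀ f ∈ I, ∀ g ∈ I, f * g = g * f) ∧
    (∀ h : F, IsCocommutative ℂ h →
      -- (ii) Heisenberg's equations of motion are of Lax form
      ((∀ s, Q.M s h (univT ℂ F) ∈ Q.UpmTensor F s) ∧
        (∀ s, oneTens h * univT ℂ F - univT ℂ F * oneTens h =
          Q.M s h (univT ℂ F) * univT ℂ F - univT ℂ F * Q.M s h (univT ℂ F)) ∧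
        (∀ T : PowerSeries (Conv ℂ F F), PowerSeries.coeff 0 T = univT ℂ F →
          ∀ s, IsHeisenberg h T ↔ IsLax Q s h T)) ∧
      -- (iii) solution by factorization (formal time)
      (∃ g : Sgn → (PowerSeries (Conv ℂ F F))ˣ, ∃ T : PowerSeries (Conv ℂ F F),
        (∀ s n, PowerSeries.coeff n (g s : PowerSeries (Conv ℂ F F)) ∈ Q.UpmTensor F s) ∧
        (((g .minus)⁻¹ * g .plus : (PowerSeries (Conv ℂ F F))ˣ) : PowerSeries (Conv ℂ F F)) =
          fexp (Complex.I • (Q.m .plus h (univT ℂ F) - Q.m .minus h (univT ℂ F))) ∧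
        (∀ s, (g s : PowerSeries (Conv ℂ F F)) =
          fexp (-(Complex.I • oneTens h)) *
            fexp (Complex.I • (oneTens h - Q.M s h (univT ℂ F)))) ∧
        (∀ s, T = g s * PowerSeries.C (univT ℂ F) * ((g s)⁻¹ : (PowerSeries (Conv ℂ F F))ˣ)) ∧
        PowerSeries.coeff 0 T = univT ℂ F ∧
        IsHeisenberg h T ∧
        (∀ s, IsLax Q s h T) ∧
        -- `g s` is the unique solution of `i dg/dt = M(t) g`, `g(0) = 1`
        (∀ s, ∀ x : PowerSeries (Conv ℂ F F),
          (Complex.I • fderivT x = fM Q s h T * x ∧ PowerSeries.coeff 0 x = 1) ↔ x = g s) ∧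
        -- the dynamical Lax equation, with respect to fixed vertices
        (∀ a b, fvertex Q a b (PowerSeries.C (univT ℂ F)) = PowerSeries.C (Q.vertexT a b)) ∧
        (∀ s a b, Complex.I • fderivT (fvertex Q a b T) =
          ∑ c, (fvertex Q a c (fM Q s h T) * fvertex Q c b T -
            fvertex Q a c T * fvertex Q c b (fM Q s h T)))) ∧
      -- (ii), dynamical Lax equation, in a matrix corepresentation and any representation of `F`
      (∀ (B : Type*) [Ring B] [Algebra ℂ B] (π : F →ₐ[ℂ] B) (ι : Type*) [Fintype ι]
        [DecidableEq ι] (c : MatrixCorep ℂ F ι) (s : Sgn) (a b : V),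
        c.vertex Q.toFaceAlgebra a b
            (Matrix.scalar ι (π h) * c.eval (repT π) - c.eval (repT π) * Matrix.scalar ι (π h)) =
          ∑ d, (c.vertex Q.toFaceAlgebra a d (c.eval (Q.M s h (repT π))) *
              c.vertex Q.toFaceAlgebra d b (c.eval (repT π)) -
            c.vertex Q.toFaceAlgebra a d (c.eval (repT π)) *
              c.vertex Q.toFaceAlgebra d b (c.eval (Q.M s h (repT π))))) ∧
      -- (ii), (iii) for real time, in a matrix corepresentation and a Banach representation of `F`
      (∀ (B : Type*) [NormedRing B] [NormedAlgebra ℂ B] [CompleteSpace B] (π : F →ₐ[ℂ] B)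
        (ι : Type*) [Fintype ι] [DecidableEq ι] (c : MatrixCorep ℂ F ι),
        (∀ (L : ℝ → Matrix ι ι B), L 0 = c.eval (repT π) → ∀ s,
          ((∀ t, HasDerivAt L (-Complex.I •
              (Matrix.scalar ι (π h) * L t - L t * Matrix.scalar ι (π h))) t) ↔
            (∀ t, HasDerivAt L (-Complex.I • (evolveM Q π c s h t * L t -
              L t * evolveM Q π c s h t)) t))) ∧
        ∃ g : Sgn → ℝ → (Matrix ι ι B)ˣ, ∃ L : ℝ → Matrix ι ι B,
          (∀ s t, ∃ X ∈ Q.UpmTensor B s, c.eval X = g s t) ∧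
          (∀ t, (((g .minus t)⁻¹ * g .plus t : (Matrix ι ι B)ˣ) : Matrix ι ι B) =
            NormedSpace.exp ((Complex.I * (t : ℂ)) •
              (c.eval (Q.m .plus h (repT π)) - c.eval (Q.m .minus h (repT π))))) ∧
          (∀ s t, (g s t : Matrix ι ι B) =
            NormedSpace.exp (-((Complex.I * (t : ℂ)) • Matrix.scalar ι (π h))) *
              NormedSpace.exp ((Complex.I * (t : ℂ)) •
                (Matrix.scalar ι (π h) - c.eval (Q.M s h (repT π))))) ∧
          (∀ s t, L t = g s t * c.eval (repT π) * ((g s t)⁻¹ : (Matrix ι ι B)ˣ)) ∧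
          L 0 = c.eval (repT π) ∧
          (∀ t, HasDerivAt L (-Complex.I •
            (Matrix.scalar ι (π h) * L t - L t * Matrix.scalar ι (π h))) t) ∧
          (∀ s t, HasDerivAt L (-Complex.I •
            (evolveM Q π c s h t * L t - L t * evolveM Q π c s h t)) t) ∧
          (∀ s, ∀ x : ℝ → Matrix ι ι B,
            ((∀ t, HasDerivAt x (-Complex.I • (evolveM Q π c s h t * x t)) t) ∧ x 0 = 1) ↔
              ∀ t, x t = g s t) ∧
          (∀ s a b t, HasDerivAt (fun r => c.vertex Q.toFaceAlgebra a b (L r))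
            (-Complex.I • ∑ d,
              (c.vertex Q.toFaceAlgebra a d (evolveM Q π c s h t) *
                  c.vertex Q.toFaceAlgebra d b (L t) -
                c.vertex Q.toFaceAlgebra a d (L t) *
                  c.vertex Q.toFaceAlgebra d b (evolveM Q π c s h t))) t))) ∧
    -- traces of corepresentations are cocommutative, and their Lax operators are given by the
    -- numerical `R`-matrices (Boltzmann weights)
    (∀ (κ : Type*) [Fintype κ] [DecidableEq κ] (c' : MatrixCorep ℂ F κ),
      IsCocommutative ℂ c'.T.trace ∧
      ∀ (B : Type*) [Ring B] [Algebra ℂ B] (π : F →ₐ[ℂ] B) (ι : Type*) [Fintype ι]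
        [DecidableEq ι] (c : MatrixCorep ℂ F ι) (a b : ι),
        c.eval (Q.M .plus c'.T.trace (repT π)) a b =
          (if a = b then π c'.T.trace else 0) -
            ∑ i, ∑ j, Q.R (c'.T j i ⊗ₜ c.T a b) • π (c'.T i j) ∧
        c.eval (Q.M .minus c'.T.trace (repT π)) a b =
          (if a = b then π c'.T.trace else 0) -
            ∑ i, ∑ j, Q.Rtilde (c.T a b ⊗ₜ c'.T j i) • π (c'.T i j)) := by
  refine ⟨⟨Q.cocommutativeSubalgebra, fun f => Iff.rfl, fun f hf g hg =>
    Q.mul_comm_of_isCocommutative hf hg⟩, fun h hh => ⟨⟨fun s => Q.M_mem_UpmSubalgebra s h _,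
    fun s => Q.M_univT_lie s hh, fun T h0 s => Q.isHeisenberg_iff_isLax s hh h0⟩,
    ⟨Q.fgUnit h, fconj (oneTens h) (univT ℂ F), fun s n => Q.coeff_fgUnit_mem h s n,
      Q.fgUnit_inv_mul hh, fun s => ?_, fun s => Q.fgUnit_conj s hh, coeff_zero_fconj _ _,
      CoquasitriangularFaceHopfAlgebra.isHeisenberg_fconj h _,
      fun s => Q.isLax_fconj s hh,
      fun s x => Q.fgUnit_ode_iff s h x,
      Q.fvertex_C_univT, fun s a b => Q.fvertex_lax (Q.isLax_fconj s hh) a b⟩,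
    ?_, ?_⟩, ?_⟩
  · rw [Q.M_univT, sub_sub_cancel, Q.val_fgUnit]
  · intro B _ _ π ι _ _ c s a b
    rw [c.vertex_lie, c.eval_M_repT, sub_mul, mul_sub]
    have hT : Commute (c.eval (Q.m s h (repT π))) (c.eval (repT π)) :=
      (Q.m_repT_commute π s hh).map (c.evalHom B)
    rw [hT.eq, sub_sub_sub_cancel_right]
  · intro B _ _ _ π ι _ _ c
    exact matrix_lax Q hh π c
  · intro κ _ _ c'
    exact ⟨c'.isCocommutative_trace, fun B _ _ π ι _ _ c a b =>
      ⟨c.eval_M_trace Q c' π .plus a b, c.eval_M_trace Q c' π .minus a b⟩⟩
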